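/- Let $\Omega=(0,1)$, $V=H^1_0(\Omega)$, $Q=BV(\Omega)$ (the functions $q\in L^1(\Omega)$ whose distributional derivative $q'$ is a finite signed Radon measure on $\Omega$), and let $\|q'\|_{\mathcal M(\Omega)}=|q'|(\Omega)$ denote the total variation norm. Let $\alpha>0$, $u_d\in L^\infty(\Omega)$, $d_0\in L^\infty(\Omega)$ with $d_0\ge 0$ a.e., and let $a\colon[0,1]\to\mathbb R$ be Lipschitz continuous with $a\ge\nu$ on $[0,1]$ for a constant $\nu>0$. Set $$\mathfrak a(v,w)=\int_\Omega a\,v'w'\,dx+\int_\Omega d_0\,v\,w\,dx\qquad(v,w\in V),$$ for $q\in Q$ let $Sq\in V$ be the unique solution of $\mathfrak a(Sq,w)=(q,w)_{L^2(\Omega)}$ for all $w\in V$, and consider the problem $$\min_{q\in Q}\ j(q),\qquad j(q)=\tfrac12\|Sq-u_d\|_{L^2(\Omega)}^2+\alpha\|q'\|_{\mathcal M(\Omega)}.\tag{P}$$ Let $\bar q\in Q$ and $\bar u\in V$. Then $\bar q$ with associated state $\bar u$ is optimal for (P), i.e. $\bar u=S\bar q$ and $j(\bar q)\le j(q)$ for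 all $q\in Q$, if and only if there exists a unique $\bar z\in W^{2,\infty}(\Omega)\cap V$ (the adjoint state) such that $$\mathfrak a(\bar u,w)=(\bar q,w)_{L^2(\Omega)}\quad\forall w\in V,\qquad \mathfrak a(w,\bar z)=(w,\bar u-u_d)_{L^2(\Omega)}\quad\forall w\in V,$$ $$-(\bar z,q-\bar q)_{L^2(\Omega)}\le\alpha\left[\|q'\|_{\mathcal M(\Omega)}-\|\bar q'\|_{\mathcal M(\Omega)}\right]\quad\forall q\in Q,$$ and such that $\bar\Phi\colon[0,1]\to\mathbb R$, $\bar\Phi(x)=\int_0^x\bar z(s)\,ds$, satisfies $$\bar\Phi\in W^{3,\infty}(\Omega),\qquad \bar\Phi(1)=0,\qquad \int_\Omega\bar\Phi\,d\bar q'=\alpha\|\bar q'\|_{\mathcal M(\Omega)},\qquad \|\bar\Phi\|_\infty\le\alpha .$$ The same equivalence holds if the conditions on $\bar\Phi$ are omitted: optimality is also equivalent to the existence of a unique $\bar z\in W^{2,\infty}(\Omega)\cap V$ satisfying only the state equation, the adjoint equation and the variational inequality. (In particular, if $\bar q$ with state $\bar u$ is optimal, this $\bar z$ automatically satisfies the conditions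 on $\bar\Phi$.) -/

import Mathlib

open MeasureTheory Set Topology
open scoped ENNReal NNReal Distributions ContDiff

namespace BVControl

/-- The spatial domain `Ω = (0, 1)`. -/
def Dom : TopologicalSpace.Opens ℝ := ⟨Ioo (0 : ℝ) 1, isOpen_Ioo⟩

/-- Lebesgue measure on `Ω`. -/
noncomputable abbrev vol : Measure ℝ := volume.restrict (Ioo (0 : ℝ) 1)

/-- Real measurable functions on `Ω`, modulo equality almost everywhere. -/
abbrev Fn : Type := ℝ →ₘ[vol] ℝ

/-- The `L²(Ω)` pairing `(f, g) = ∫_Ω f g`. -/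
noncomputable def pairing (f g : ℝ → ℝ) : ℝ := ∫ x, f x * g x ∂vol

/-! ### Sobolev spaces on `Ω` -/

/-- `v` is the weak derivative of `u` on `Ω` (both locally integrable on `Ω`), tested against
smooth functions `φ` with compact support in `Ω`. -/
def IsWeakDeriv (u v : ℝ → ℝ) : Prop :=
  LocallyIntegrableOn u (Ioo 0 1) ∧ LocallyIntegrableOn v (Ioo 0 1) ∧
    ∀ φ : 𝓓(Dom, ℝ), ∫ x, u x * deriv φ x ∂vol = -∫ x, v x * φ x ∂vol

open scoped Classical in
/-- The weak derivative of `u`, which is unique up to almost everywhere equality on `Ω`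
(and the junk value `0` if there is none). -/
noncomputable def weakDeriv (u : ℝ → ℝ) : ℝ → ℝ :=
  if h : ∃ v, IsWeakDeriv u v then h.choose else 0

/-- `u ∈ W^{k,p}(Ω)`: the weak derivatives of order `0, …, k` exist and belong to `L^p(Ω)`. -/
def MemW : ℕ → ℝ≥0∞ → (ℝ → ℝ) → Prop
  | 0, p, u => MemLp u p vol
  | k + 1, p, u => MemLp u p vol ∧ ∃ v, IsWeakDeriv u v ∧ MemW k p v

/-- `u ∈ V = H¹₀(Ω)`, the closure of the smooth functions with compact support in `Ω` with
respect to the norm of `H¹(Ω) = W^{1,2}(Ω)`. -/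
def MemH10 (u : ℝ → ℝ) : Prop :=
  MemW 1 2 u ∧ ∀ ε : ℝ≥0∞, 0 < ε → ∃ φ : 𝓓(Dom, ℝ),
    eLpNorm (fun x => u x - φ x) 2 vol < ε ∧
    eLpNorm (fun x => weakDeriv u x - deriv φ x) 2 vol < ε

/-! ### Functions of bounded variation on `Ω` -/

/-- The finite signed Radon measure `m` on `Ω` is the distributional derivative of `q`. -/
def IsMeasureDeriv (q : ℝ → ℝ) (m : SignedMeasure Dom) : Prop :=
  ∀ φ : 𝓓(Dom, ℝ), ∫ x, q x * deriv φ x ∂vol = -∫ᵛ x, φ (x : ℝ) ∂<•m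

/-- `q ∈ Q = BV(Ω)`. -/
def MemBV (q : ℝ → ℝ) : Prop :=
  Integrable q vol ∧ ∃ m : SignedMeasure Dom, IsMeasureDeriv q m

open scoped Classical in
/-- The distributional derivative `q'` of `q ∈ BV(Ω)` as a signed measure on `Ω`, which is unique
(and the junk value `0` if there is none). -/
noncomputable def measureDeriv (q : ℝ → ℝ) : SignedMeasure Dom :=
  if h : ∃ m : SignedMeasure Dom, IsMeasureDeriv q m then h.choose else 0

/-- The total variation norm `‖m‖_{M(Ω)} = |m|(Ω)`. -/
noncomputable def tvNorm (m : SignedMeasure Dom) : ℝ := (m.variation univ).toReal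

/-! ### The optimal control problem -/

/-- The bilinear form `𝔞(v, w) = (a v', w') + (d₀ v, w)`. -/
noncomputable def bilin (a d₀ v w : ℝ → ℝ) : ℝ :=
  pairing (fun x => a x * weakDeriv v x) (weakDeriv w) + pairing (fun x => d₀ x * v x) w

/-- `u ∈ V` solves the state equation `𝔞(u, w) = (q, w)` for all `w ∈ V`. -/
def IsState (a d₀ q u : ℝ → ℝ) : Prop :=
  MemH10 u ∧ ∀ w : Fn, MemH10 w → bilin a d₀ u w = pairing q w

open scoped Classical in
/-- The control-to-state operator `S`: `S q` is the unique solution in `V` of the state equation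
with control `q` (and the junk value `0` if there is none, which does not happen for
`q ∈ BV(Ω)`). -/
noncomputable def S (a d₀ q : ℝ → ℝ) : Fn :=
  if h : ∃ u : Fn, IsState a d₀ q u then h.choose else 0

/-- `J(u, q) = ½ ‖u - u_d‖²_{L²(Ω)} + α ‖q'‖_{M(Ω)}`. -/
noncomputable def J (α : ℝ) (ud u q : ℝ → ℝ) : ℝ :=
  1 / 2 * (eLpNorm (fun x => u x - ud x) 2 vol).toReal ^ 2 + α * tvNorm (measureDeriv q)

/-- The reduced objective `j(q) = J(S q, q)`. -/
noncomputable def reducedJ (α : ℝ) (a d₀ ud q : ℝ → ℝ) : ℝ := J α ud (S a d₀ q) q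

/-- The control `q̄ ∈ BV(Ω)` with associated state `ū = S q̄` is optimal: `q̄` minimizes `j` over
`BV(Ω)`. -/
def IsOptimal (α : ℝ) (a d₀ ud : ℝ → ℝ) (qb ub : Fn) : Prop :=
  MemBV qb ∧ ub = S a d₀ qb ∧
    ∀ q : Fn, MemBV q → reducedJ α a d₀ ud qb ≤ reducedJ α a d₀ ud q

/-- `z ∈ W^{2,∞}(Ω) ∩ V`, together with `(ū, q̄)`, satisfies the state equation, the adjoint
equation and the variational inequality. -/
def IsAdjointState (α : ℝ) (a d₀ ud : ℝ → ℝ) (qb ub z : Fn) : Prop :=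
  (MemW 2 ∞ z ∧ MemH10 z) ∧
  (∀ w : Fn, MemH10 w → bilin a d₀ ub w = pairing qb w) ∧
  (∀ w : Fn, MemH10 w → bilin a d₀ w z = pairing w (fun x => ub x - ud x)) ∧
  (∀ q : Fn, MemBV q → -pairing z (fun x => q x - qb x) ≤
    α * (tvNorm (measureDeriv q) - tvNorm (measureDeriv qb)))

/-- `Φ(x) = ∫₀ˣ z(s) ds`, to be used for `x ∈ [0, 1]`. -/
noncomputable def Phi (z : Fn) (x : ℝ) : ℝ := ∫ s in (0 : ℝ)..x, z s

/-- `Φ` belongs to `W^{3,∞}(Ω)`, `Φ(1) = 0`, `∫_Ω Φ dq̄' = α ‖q̄'‖_{M(Ω)}` and `‖Φ‖_∞ ≤ α`. -/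
def MultiplierConditions (α : ℝ) (qb z : Fn) : Prop :=
  MemW 3 ∞ (Phi z) ∧ Phi z 1 = 0 ∧
  ∫ᵛ x, Phi z (x : ℝ) ∂<•(measureDeriv qb) = α * tvNorm (measureDeriv qb) ∧
  ∀ x ∈ Icc (0 : ℝ) 1, |Phi z x| ≤ α

end BVControl

/-! The functional `reducedJ` is a convex quadratic plus `α` times a seminorm, so optimality is
equivalent to a first-order condition. In direction `d` the derivative of the tracking term is `(S
d, ub - ud)`. Since the bilinear form is symmetric, this equals `(z, d)`, where `z` solves the state
equation with data `ub - ud` (`pairing_adjoint`). Necessity comes from comparing `qb` with points on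
the segment towards `q` and letting the step tend to `0`. Sufficiency holds because the quadratic
remainder is nonnegative.

Everything rests on a one-dimensional description of `H¹₀`: its elements are exactly the primitives
`prim g` of mean-zero `g ∈ L²` (`MemH10.ae_eq_prim`, `memH10_of_prim`). The form then becomes a
bounded coercive form on a closed subspace of `L²`, and Lax–Milgram gives existence
(`exists_form_eq`), coercivity uniqueness. Integrating the equation once expresses `z'` as a
Lipschitz function divided by `a`, whence `z ∈ W^{2,∞}` (`IsState.memW_two`).

The conditions on `Φ = prim z` follow from the variational inequality by testing with `qb + c` (mean
of `z`), with `c * qb` (equality case) and with step functions (bound by `α`), see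
`multiplierConditions`. The link between `∫ Φ dq'` and `-(z, q)` is `integral_prim_measureDeriv`.
Hence the conditions on `Φ` are automatic, and `z` is already unique through the adjoint equation
alone. -/

namespace BVControl
open Filter

/-! ### Signed measures -/

instance instFiniteVariation {X : Type*} [MeasurableSpace X] (m : SignedMeasure X) :
    IsFiniteMeasure m.variation := by
  rw [← m.totalVariation_eq_variation, SignedMeasure.totalVariation]
  infer_instance

theorem tvNorm_add_le (m n : SignedMeasure Dom) : tvNorm (m + n) ≤ tvNorm m + tvNorm n := by
  unfold tvNorm
  rw [← ENNReal.toReal_add (measure_ne_top _ _) (measure_ne_top _ _)]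
  exact ENNReal.toReal_mono (by finiteness)
    (VectorMeasure.variation_add_le (μ := m) (ν := n) univ)

theorem tvNorm_smul (c : ℝ) (m : SignedMeasure Dom) : tvNorm (c • m) = |c| * tvNorm m := by
  unfold tvNorm
  rw [VectorMeasure.variation_smul]
  simp [Measure.nnreal_smul_coe_apply]

theorem tvNorm_dirac (x : Dom) (c : ℝ) : tvNorm (VectorMeasure.dirac x c) = |c| := by
  simp [tvNorm]

theorem integrable_of_continuous_bound (m : SignedMeasure Dom) {f : ℝ → ℝ} {C : ℝ}
    (hf : ContinuousOn f (Ioo 0 1)) (hC : ∀ x ∈ Ioo (0 : ℝ) 1, |f x| ≤ C) :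
    m.Integrable (fun x : Dom => f x) := by
  have hc : Continuous (fun x : Dom => f x) :=
    hf.comp_continuous continuous_subtype_val fun x => x.2
  exact Integrable.of_bound hc.aestronglyMeasurable C (Eventually.of_forall fun x => hC x x.2)

/-! ### Test functions -/

theorem testFunction_bound (φ : 𝓓(Dom, ℝ)) : ∃ C, ∀ x, |φ x| ≤ C :=
  φ.continuous.bounded_above_of_compact_support φ.hasCompactSupport

theorem integrable_testFunction (m : SignedMeasure Dom) (φ : 𝓓(Dom, ℝ)) :
    m.Integrable (fun x : Dom => φ x) := by
  obtain ⟨C, hC⟩ := testFunction_bound φ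
  exact integrable_of_continuous_bound m φ.continuous.continuousOn fun x _ => hC x

/-- A function which is smooth and vanishes outside `[a, b] ⊆ Ω` is a test function. -/
def mkTest (f : ℝ → ℝ) (hf : ContDiff ℝ ∞ f) (a b : ℝ) (ha : 0 < a) (hb : b < 1)
    (h0 : ∀ x ∉ Icc a b, f x = 0) : 𝓓(Dom, ℝ) where
  toFun := f
  contDiff' := hf
  hasCompactSupport' := HasCompactSupport.intro isCompact_Icc h0
  tsupport_subset' := by
    refine (closure_minimal (fun x hx => ?_) isClosed_Icc : tsupport f ⊆ Icc a b).trans ?_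
    · by_contra h
      exact hx (h0 x h)
    · exact fun x hx => ⟨ha.trans_le hx.1, hx.2.trans_lt hb⟩

@[simp] theorem mkTest_apply (f : ℝ → ℝ) (hf a b ha hb h0) (x : ℝ) :
    mkTest f hf a b ha hb h0 x = f x := rfl

/-- Smooth functions increasing to the indicator function of `(c, d)`. -/
noncomputable def bump (c d : ℝ) (n : ℕ) (x : ℝ) : ℝ :=
  Real.smoothTransition (n * (x - c) - 1) * Real.smoothTransition (n * (d - x) - 1)

theorem contDiff_bump (c d : ℝ) (n : ℕ) : ContDiff ℝ ∞ (bump c d n) := by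
  unfold bump
  exact (Real.smoothTransition.contDiff.comp (by fun_prop)).mul
    (Real.smoothTransition.contDiff.comp (by fun_prop))

theorem bump_nonneg (c d : ℝ) (n : ℕ) (x : ℝ) : 0 ≤ bump c d n x :=
  mul_nonneg (Real.smoothTransition.nonneg _) (Real.smoothTransition.nonneg _)

theorem bump_le_one (c d : ℝ) (n : ℕ) (x : ℝ) : bump c d n x ≤ 1 :=
  mul_le_one₀ (Real.smoothTransition.le_one _) (Real.smoothTransition.nonneg _)
    (Real.smoothTransition.le_one _)

theorem abs_bump_le_one (c d : ℝ) (n : ℕ) (x : ℝ) : |bump c d n x| ≤ 1 := by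
  rw [abs_of_nonneg (bump_nonneg ..)]
  exact bump_le_one ..

/-- The shift by `-1` in `bump` keeps the support at distance at least `1 / (n + 1)` from `c` and
`d`, hence compact in `(c, d)`; the index `n + 1` avoids dividing by zero. -/
theorem bump_eq_zero {c d : ℝ} {n : ℕ} {x : ℝ}
    (hx : x ∉ Icc (c + 1 / (n + 1 : ℝ)) (d - 1 / (n + 1 : ℝ))) : bump c d (n + 1) x = 0 := by
  have hn : (0 : ℝ) < n + 1 := by positivity
  rw [mem_Icc, not_and_or, not_le, not_le] at hx
  rcases hx with hx | hx
  · have : (n + 1 : ℝ) * (x - c) < (n + 1) * (1 / (n + 1)) := by gcongr; linarith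
    rw [mul_one_div_cancel hn.ne'] at this
    rw [bump, Real.smoothTransition.zero_of_nonpos (by push_cast; linarith), zero_mul]
  · have : (n + 1 : ℝ) * (d - x) < (n + 1) * (1 / (n + 1)) := by gcongr; linarith
    rw [mul_one_div_cancel hn.ne'] at this
    rw [bump, mul_comm, Real.smoothTransition.zero_of_nonpos (by push_cast; linarith), zero_mul]

theorem eventually_bump_eq_one {c d x : ℝ} (hx : x ∈ Ioo c d) :
    ∀ᶠ n : ℕ in atTop, bump c d n x = 1 := by
  have h1 : Tendsto (fun n : ℕ => (n : ℝ) * (x - c)) atTop atTop :=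
    tendsto_natCast_atTop_atTop.atTop_mul_const (sub_pos.2 hx.1)
  have h2 : Tendsto (fun n : ℕ => (n : ℝ) * (d - x)) atTop atTop :=
    tendsto_natCast_atTop_atTop.atTop_mul_const (sub_pos.2 hx.2)
  filter_upwards [h1.eventually_ge_atTop 2, h2.eventually_ge_atTop 2] with n hn1 hn2
  rw [bump, Real.smoothTransition.one_of_one_le (by linarith),
    Real.smoothTransition.one_of_one_le (by linarith), one_mul]

/-- The cut-off function `bump c d (n + 1)` as a test function. -/
noncomputable def bumpTest (c d : ℝ) (hc : 0 ≤ c) (hd : d ≤ 1) (n : ℕ) : 𝓓(Dom, ℝ) :=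
  mkTest (bump c d (n + 1)) (contDiff_bump _ _ _) (c + 1 / (n + 1 : ℝ)) (d - 1 / (n + 1 : ℝ))
    (by positivity) (by have : (0 : ℝ) < 1 / (n + 1 : ℝ) := by positivity
                        linarith) fun _ => bump_eq_zero

theorem tendsto_bump (c d x : ℝ) :
    Tendsto (fun n : ℕ => bump c d (n + 1) x) atTop (𝓝 ((Ioo c d).indicator 1 x)) := by
  by_cases hx : x ∈ Ioo c d
  · rw [indicator_of_mem hx]
    exact tendsto_const_nhds.congr' ((tendsto_add_atTop_nat 1).eventually
      (eventually_bump_eq_one hx) |>.mono fun n hn => hn.symm)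
  · rw [indicator_of_notMem hx]
    refine tendsto_const_nhds.congr fun n => (bump_eq_zero fun h => hx ?_).symm
    have : (0 : ℝ) < 1 / (n + 1 : ℝ) := by positivity
    exact ⟨by linarith [h.1], by linarith [h.2]⟩

/-- By dominated convergence the integrals of cut-offs tend to the measure of an interval, and
intervals with rational endpoints determine a finite measure. Endpoints are clamped to `[0, 1]` so
that the cut-offs are admissible. -/
theorem measure_eq_of_integral_testFunction_eq (μ ν : Measure Dom) [IsFiniteMeasure μ]
    [IsFiniteMeasure ν] (h : ∀ φ : 𝓓(Dom, ℝ), ∫ x, φ (x : ℝ) ∂μ = ∫ x, φ (x : ℝ) ∂ν) : μ = ν := by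
  have key (p q : ℝ) : μ.map (↑) (Ioo p q) = ν.map (↑) (Ioo p q) := by
    have lim (ρ : Measure Dom) [IsFiniteMeasure ρ] :
        Tendsto (fun n => ∫ x, bumpTest (max p 0) (min q 1) (le_max_right _ _) (min_le_right _ _) n
          (x : ℝ) ∂ρ) atTop (𝓝 (ρ.real ((↑) ⁻¹' Ioo p q))) := by
      have hm : MeasurableSet ((↑) ⁻¹' Ioo p q : Set Dom) :=
        measurable_subtype_coe measurableSet_Ioo
      rw [← integral_indicator_one hm]
      refine tendsto_integral_of_dominated_convergence 1
        (fun n => ((bumpTest _ _ _ _ n).continuous.comp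
          continuous_subtype_val).aestronglyMeasurable) (integrable_const 1)
        (fun n => Eventually.of_forall fun x => abs_bump_le_one _ _ _ _)
        (Eventually.of_forall fun x => ?_)
      have : ((↑) ⁻¹' Ioo p q : Set Dom).indicator (1 : Dom → ℝ) x =
          (Ioo (max p 0) (min q 1)).indicator 1 (x : ℝ) := by
        have hx : (x : ℝ) ∈ Ioo (0 : ℝ) 1 := x.2
        by_cases h : (x : ℝ) ∈ Ioo p q
        · rw [indicator_of_mem (show x ∈ ((↑) ⁻¹' Ioo p q : Set Dom) from h),
            indicator_of_mem (show (x : ℝ) ∈ Ioo (max p 0) (min q 1) from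
              ⟨max_lt h.1 hx.1, lt_min h.2 hx.2⟩)]
          rfl
        · rw [indicator_of_notMem (show x ∉ ((↑) ⁻¹' Ioo p q : Set Dom) from h),
            indicator_of_notMem fun h' : (x : ℝ) ∈ Ioo _ _ =>
              h ⟨(le_max_left _ _).trans_lt h'.1, h'.2.trans_le (min_le_left _ _)⟩]
      rw [this]
      exact tendsto_bump _ _ _
    have := tendsto_nhds_unique (lim μ) (by simpa only [h] using lim ν)
    rw [Measure.map_apply measurable_subtype_coe measurableSet_Ioo,
      Measure.map_apply measurable_subtype_coe measurableSet_Ioo]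
    exact (measureReal_eq_measureReal_iff).1 this
  have hmap : μ.map ((↑) : Dom → ℝ) = ν.map (↑) := Real.measure_ext_Ioo_rat fun a b => key a b
  have he : MeasurableEmbedding ((↑) : Dom → ℝ) :=
    MeasurableEmbedding.subtype_coe measurableSet_Ioo
  rw [← he.comap_map μ, ← he.comap_map ν, hmap]

theorem integral_eq_jordan (m : SignedMeasure Dom) (φ : 𝓓(Dom, ℝ)) :
    ∫ᵛ x, φ (x : ℝ) ∂<•m = ∫ x, φ (x : ℝ) ∂m.toJordanDecomposition.posPart -
      ∫ x, φ (x : ℝ) ∂m.toJordanDecomposition.negPart := by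
  conv_lhs => rw [← m.toSignedMeasure_toJordanDecomposition, JordanDecomposition.toSignedMeasure]
  rw [VectorMeasure.integral_sub_vectorMeasure (integrable_testFunction _ _)
    (integrable_testFunction _ _), VectorMeasure.integral_toSignedMeasure,
    VectorMeasure.integral_toSignedMeasure]

theorem signedMeasure_eq_zero (m : SignedMeasure Dom)
    (h : ∀ φ : 𝓓(Dom, ℝ), ∫ᵛ x, φ (x : ℝ) ∂<•m = 0) : m = 0 := by
  have := measure_eq_of_integral_testFunction_eq m.toJordanDecomposition.posPart
    m.toJordanDecomposition.negPart fun φ => by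
      have := h φ
      rwa [integral_eq_jordan, sub_eq_zero] at this
  rw [← m.toSignedMeasure_toJordanDecomposition, JordanDecomposition.toSignedMeasure]
  simp [this]

/-! ### The distributional derivative -/

theorem IsMeasureDeriv.unique {q : ℝ → ℝ} {m n : SignedMeasure Dom} (hm : IsMeasureDeriv q m)
    (hn : IsMeasureDeriv q n) : m = n := by
  rw [← sub_eq_zero]
  refine signedMeasure_eq_zero _ fun φ => ?_
  rw [VectorMeasure.integral_sub_vectorMeasure (integrable_testFunction _ _)
    (integrable_testFunction _ _), sub_eq_zero, ← neg_inj, ← hm φ, ← hn φ]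

theorem IsMeasureDeriv.measureDeriv_eq {q : ℝ → ℝ} {m : SignedMeasure Dom}
    (hm : IsMeasureDeriv q m) : measureDeriv q = m := by
  have h : ∃ m, IsMeasureDeriv q m := ⟨m, hm⟩
  rw [measureDeriv, dif_pos h]
  exact h.choose_spec.unique hm

theorem MemBV.isMeasureDeriv {q : ℝ → ℝ} (h : MemBV q) : IsMeasureDeriv q (measureDeriv q) := by
  obtain ⟨m, hm⟩ := h.2
  rwa [hm.measureDeriv_eq]

theorem IsMeasureDeriv.congr {q r : ℝ → ℝ} {m : SignedMeasure Dom}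
    (hm : IsMeasureDeriv q m) (h : q =ᵐ[vol] r) : IsMeasureDeriv r m := fun φ => by
  rw [← hm φ]
  refine integral_congr_ae ?_
  filter_upwards [h] with x hx
  rw [hx]

theorem testFunction_deriv_bound (φ : 𝓓(Dom, ℝ)) : ∃ C, ∀ x, |deriv φ x| ≤ C :=
  (φ.contDiff.continuous_deriv (by simp)).bounded_above_of_compact_support
    φ.hasCompactSupport.deriv

theorem continuous_deriv_testFunction (φ : 𝓓(Dom, ℝ)) : Continuous (deriv φ) :=
  φ.contDiff.continuous_deriv (by simp)

theorem integrable_mul_bounded {q f : ℝ → ℝ} (hq : Integrable q vol)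
    (hf : AEStronglyMeasurable f vol) {C : ℝ} (hC : ∀ᵐ x ∂vol, |f x| ≤ C) :
    Integrable (fun x => q x * f x) vol := hq.mul_bdd hf hC

theorem integrable_mul_deriv {q : ℝ → ℝ} (hq : Integrable q vol) (φ : 𝓓(Dom, ℝ)) :
    Integrable (fun x => q x * deriv φ x) vol := by
  obtain ⟨C, hC⟩ := testFunction_deriv_bound φ
  exact integrable_mul_bounded hq (continuous_deriv_testFunction φ).aestronglyMeasurable
    (Eventually.of_forall hC)

theorem IsMeasureDeriv.add {q r : ℝ → ℝ} {m n : SignedMeasure Dom} (hq : Integrable q vol)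
    (hr : Integrable r vol) (hm : IsMeasureDeriv q m) (hn : IsMeasureDeriv r n) :
    IsMeasureDeriv (fun x => q x + r x) (m + n) := fun φ => by
  simp_rw [add_mul]
  rw [integral_add (integrable_mul_deriv hq φ) (integrable_mul_deriv hr φ), hm φ, hn φ,
    VectorMeasure.integral_add_vectorMeasure (integrable_testFunction _ _)
      (integrable_testFunction _ _), neg_add]

theorem IsMeasureDeriv.smul {q : ℝ → ℝ} {m : SignedMeasure Dom} (hm : IsMeasureDeriv q m)
    (c : ℝ) : IsMeasureDeriv (fun x => c * q x) (c • m) := fun φ => by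
  simp_rw [mul_assoc]
  rw [integral_const_mul, hm φ, VectorMeasure.integral_smul_vectorMeasure, smul_eq_mul, mul_neg]

theorem testFunction_eq_zero (φ : 𝓓(Dom, ℝ)) {x : ℝ} (hx : x ∉ Ioo (0 : ℝ) 1) : φ x = 0 :=
  image_eq_zero_of_notMem_tsupport fun h => hx (φ.tsupport_subset h)

theorem integral_vol_eq (f : ℝ → ℝ) : ∫ x, f x ∂vol = ∫ x in (0 : ℝ)..1, f x := by
  rw [intervalIntegral.integral_of_le zero_le_one, integral_Ioc_eq_integral_Ioo]

theorem intervalIntegral_deriv_testFunction (φ : 𝓓(Dom, ℝ)) (x y : ℝ) :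
    ∫ t in x..y, deriv φ t = φ y - φ x :=
  intervalIntegral.integral_deriv_eq_sub
    (fun t _ => (φ.contDiff.differentiable (by simp)).differentiableAt)
    ((continuous_deriv_testFunction φ).intervalIntegrable _ _)

theorem isMeasureDeriv_const (c : ℝ) : IsMeasureDeriv (fun _ => c) 0 := fun φ => by
  rw [integral_const_mul, integral_vol_eq, intervalIntegral_deriv_testFunction,
    testFunction_eq_zero φ (by simp), testFunction_eq_zero φ (by simp),
    VectorMeasure.integral_zero_vectorMeasure]
  simp

/-- Steps have Dirac derivatives; as competitors they read off the value of `Φ` at the jump. -/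
theorem isMeasureDeriv_step (y : Dom) (c : ℝ) :
    IsMeasureDeriv ((Ioo (y : ℝ) 1).indicator fun _ => c) (VectorMeasure.dirac y c) := fun φ => by
  have hy : (y : ℝ) ∈ Ioo (0 : ℝ) 1 := y.2
  have h1 : (fun x => (Ioo (y : ℝ) 1).indicator (fun _ => c) x * deriv φ x) =
      (Ioo (y : ℝ) 1).indicator fun x => c * deriv φ x := by
    ext x
    by_cases hx : x ∈ Ioo (y : ℝ) 1 <;> simp [hx]
  rw [VectorMeasure.integral_dirac, h1, integral_indicator measurableSet_Ioo,
    Measure.restrict_restrict measurableSet_Ioo,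
    inter_eq_left.2 (Ioo_subset_Ioo_left hy.1.le), ← integral_Ioc_eq_integral_Ioo,
    ← intervalIntegral.integral_of_le hy.2.le, intervalIntegral.integral_const_mul,
    intervalIntegral_deriv_testFunction, testFunction_eq_zero φ (by simp : (1 : ℝ) ∉ Ioo (0 : ℝ) 1)]
  simp

/-! ### Square integrable functions and primitives -/

instance instProbVol : IsProbabilityMeasure vol := ⟨by simp⟩

/-- The norm of `L²(Ω)`. -/
noncomputable def nrm (f : ℝ → ℝ) : ℝ := (eLpNorm f 2 vol).toReal

theorem nrm_nonneg (f : ℝ → ℝ) : 0 ≤ nrm f := ENNReal.toReal_nonneg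

theorem nrm_sq {f : ℝ → ℝ} (hf : MemLp f 2 vol) : nrm f ^ 2 = ∫ x, f x * f x ∂vol := by
  have h := hf.eLpNorm_eq_integral_rpow_norm (by simp) (by simp)
  have h0 : 0 ≤ ∫ x, f x * f x ∂vol := integral_nonneg fun x => mul_self_nonneg _
  have h1 : (∫ x, ‖f x‖ ^ (2 : ℝ≥0∞).toReal ∂vol) = ∫ x, f x * f x ∂vol := by
    refine integral_congr_ae (Eventually.of_forall fun x => ?_)
    simp [← sq]
  rw [h1] at h
  rw [nrm, h, ENNReal.toReal_ofReal (by positivity), ← Real.rpow_natCast, ← Real.rpow_mul h0]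
  simp

theorem ofReal_nrm {f : ℝ → ℝ} (hf : MemLp f 2 vol) :
    ENNReal.ofReal (nrm f) = eLpNorm f 2 vol := ENNReal.ofReal_toReal hf.2.ne

theorem nrm_add_le {f g : ℝ → ℝ} (hf : MemLp f 2 vol) (hg : MemLp g 2 vol) :
    nrm (f + g) ≤ nrm f + nrm g := by
  rw [nrm, nrm, nrm, ← ENNReal.toReal_add hf.2.ne hg.2.ne]
  exact ENNReal.toReal_mono (by simp [hf.2.ne, hg.2.ne]) (eLpNorm_add_le hf.1 hg.1 (by norm_num))

theorem integrable_of_memLp_two {f : ℝ → ℝ} (hf : MemLp f 2 vol) : Integrable f vol :=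
  hf.integrable (by norm_num)

theorem integral_abs_le_nrm {f : ℝ → ℝ} (hf : MemLp f 2 vol) : ∫ x, |f x| ∂vol ≤ nrm f := by
  have h := eLpNorm_le_eLpNorm_of_exponent_le (μ := vol) (p := 1) (q := 2) (by norm_num) hf.1
  rw [eLpNorm_one_eq_lintegral_enorm] at h
  have h2 : ∫ x, |f x| ∂vol = (∫⁻ x, ‖f x‖ₑ ∂vol).toReal := by
    simpa using integral_norm_eq_lintegral_enorm hf.1
  rw [h2]
  exact ENNReal.toReal_mono hf.2.ne h

theorem abs_integral_le_nrm {f : ℝ → ℝ} (hf : MemLp f 2 vol) : |∫ x, f x ∂vol| ≤ nrm f :=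
  (abs_integral_le_integral_abs).trans (integral_abs_le_nrm hf)

theorem memLp_of_continuousOn {f : ℝ → ℝ} (hf : ContinuousOn f (Icc 0 1)) (p : ℝ≥0∞) :
    MemLp f p vol := by
  obtain ⟨C, hC⟩ := isCompact_Icc.exists_bound_of_continuousOn hf
  refine MemLp.of_bound ((hf.mono Ioo_subset_Icc_self).aestronglyMeasurable measurableSet_Ioo) C ?_
  filter_upwards [ae_restrict_mem measurableSet_Ioo] with x hx
  exact hC x (Ioo_subset_Icc_self hx)

theorem nrm_le_of_bound {f : ℝ → ℝ} {C : ℝ} (hC0 : 0 ≤ C) (hC : ∀ᵐ x ∂vol, |f x| ≤ C) :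
    nrm f ≤ C := by
  have := eLpNorm_le_of_ae_bound (p := 2) (μ := vol) (f := f) hC
  rw [measure_univ, ENNReal.one_rpow, one_mul] at this
  exact ENNReal.toReal_le_of_le_ofReal hC0 this

/-- The primitive of `g` vanishing at `0`. -/
noncomputable def prim (g : ℝ → ℝ) (x : ℝ) : ℝ := ∫ s in (0 : ℝ)..x, g s

theorem intervalIntegrable_of_vol {g : ℝ → ℝ} (hg : Integrable g vol) :
    IntervalIntegrable g volume 0 1 :=
  (intervalIntegrable_iff_integrableOn_Ioo_of_le zero_le_one).2 hg

theorem intervalIntegrable_sub {g : ℝ → ℝ} (hg : Integrable g vol) {x y : ℝ}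
    (hx : x ∈ Icc (0 : ℝ) 1) (hy : y ∈ Icc (0 : ℝ) 1) : IntervalIntegrable g volume x y :=
  (intervalIntegrable_of_vol hg).mono_set (by
    rw [uIcc_of_le zero_le_one]
    exact uIcc_subset_Icc hx hy)

@[simp] theorem prim_zero_right (g : ℝ → ℝ) : prim g 0 = 0 := intervalIntegral.integral_same

theorem prim_one (g : ℝ → ℝ) : prim g 1 = ∫ x, g x ∂vol := (integral_vol_eq g).symm

theorem prim_eq_setIntegral (g : ℝ → ℝ) {x : ℝ} (hx : x ∈ Icc (0 : ℝ) 1) :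
    prim g x = ∫ s in Ioo 0 x, g s ∂vol := by
  rw [prim, intervalIntegral.integral_of_le hx.1, integral_Ioc_eq_integral_Ioo,
    Measure.restrict_restrict measurableSet_Ioo, inter_eq_left.2 (Ioo_subset_Ioo_right hx.2)]

theorem prim_congr {g h : ℝ → ℝ} (hgh : g =ᵐ[vol] h) {x : ℝ} (hx : x ∈ Icc (0 : ℝ) 1) :
    prim g x = prim h x := by
  rw [prim_eq_setIntegral g hx, prim_eq_setIntegral h hx]
  exact integral_congr_ae (ae_restrict_of_ae hgh)

theorem abs_prim_le {g : ℝ → ℝ} (hg : Integrable g vol) {x : ℝ} (hx : x ∈ Icc (0 : ℝ) 1) :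
    |prim g x| ≤ ∫ s, |g s| ∂vol := by
  rw [prim_eq_setIntegral g hx]
  refine abs_integral_le_integral_abs.trans ?_
  exact setIntegral_le_integral hg.abs (Eventually.of_forall fun _ => abs_nonneg _)

theorem abs_prim_le_nrm {g : ℝ → ℝ} (hg : MemLp g 2 vol) {x : ℝ} (hx : x ∈ Icc (0 : ℝ) 1) :
    |prim g x| ≤ nrm g :=
  (abs_prim_le (integrable_of_memLp_two hg) hx).trans (integral_abs_le_nrm hg)

theorem ae_vol_mem : ∀ᵐ x ∂vol, x ∈ Ioo (0 : ℝ) 1 := ae_restrict_mem measurableSet_Ioo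

theorem ae_vol_mem_Icc : ∀ᵐ x ∂vol, x ∈ Icc (0 : ℝ) 1 :=
  ae_vol_mem.mono fun _ hx => Ioo_subset_Icc_self hx

theorem prim_add {g h : ℝ → ℝ} (hg : Integrable g vol) (hh : Integrable h vol) {x : ℝ}
    (hx : x ∈ Icc (0 : ℝ) 1) : prim (g + h) x = prim g x + prim h x :=
  intervalIntegral.integral_add (intervalIntegrable_sub hg (by simp) hx)
    (intervalIntegrable_sub hh (by simp) hx)

theorem prim_sub {g h : ℝ → ℝ} (hg : Integrable g vol) (hh : Integrable h vol) {x : ℝ}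
    (hx : x ∈ Icc (0 : ℝ) 1) : prim (g - h) x = prim g x - prim h x :=
  intervalIntegral.integral_sub (intervalIntegrable_sub hg (by simp) hx)
    (intervalIntegrable_sub hh (by simp) hx)

theorem prim_smul (c : ℝ) (g : ℝ → ℝ) (x : ℝ) : prim (c • g) x = c * prim g x :=
  intervalIntegral.integral_const_mul c g

theorem absolutelyContinuous_prim {g : ℝ → ℝ} (hg : Integrable g vol) :
    AbsolutelyContinuousOnInterval (prim g) 0 1 :=
  (intervalIntegrable_of_vol hg).absolutelyContinuousOnInterval_intervalIntegral (by simp)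

theorem continuousOn_prim {g : ℝ → ℝ} (hg : Integrable g vol) :
    ContinuousOn (prim g) (Icc 0 1) := by
  simpa using (absolutelyContinuous_prim hg).continuousOn

theorem deriv_prim {g : ℝ → ℝ} (hg : Integrable g vol) : deriv (prim g) =ᵐ[vol] g := by
  filter_upwards [ae_restrict_of_ae (intervalIntegrable_of_vol hg).ae_hasDerivAt_integral,
    ae_vol_mem_Icc] with x hx hx1
  rw [uIcc_of_le zero_le_one] at hx
  exact (hx hx1 0 (by simp)).deriv

theorem prim_deriv_testFunction (φ : 𝓓(Dom, ℝ)) (x : ℝ) : prim (deriv φ) x = φ x := by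
  rw [prim, intervalIntegral_deriv_testFunction, testFunction_eq_zero φ (x := 0) (by simp),
    sub_zero]

theorem integral_deriv_testFunction (φ : 𝓓(Dom, ℝ)) : ∫ x, deriv φ x ∂vol = 0 := by
  rw [← prim_one, prim_deriv_testFunction, testFunction_eq_zero φ (by simp)]

theorem memLp_testFunction_deriv (φ : 𝓓(Dom, ℝ)) (p : ℝ≥0∞) : MemLp (deriv φ) p vol :=
  memLp_of_continuousOn (continuous_deriv_testFunction φ).continuousOn p

theorem memLp_testFunction (φ : 𝓓(Dom, ℝ)) (p : ℝ≥0∞) : MemLp φ p vol :=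
  memLp_of_continuousOn φ.continuous.continuousOn p

/-- Only `v` has to vanish at the endpoints, so `u` may be any primitive. -/
theorem integral_mul_deriv_of_ac {u v g h : ℝ → ℝ} (hu : AbsolutelyContinuousOnInterval u 0 1)
    (hv : AbsolutelyContinuousOnInterval v 0 1) (hg : deriv u =ᵐ[vol] g)
    (hh : deriv v =ᵐ[vol] h) (h0 : v 0 = 0) (h1 : v 1 = 0) :
    ∫ x, u x * h x ∂vol = -∫ x, g x * v x ∂vol := by
  have hab := hu.integral_mul_deriv_eq_deriv_mul hv
  rw [← integral_vol_eq, ← integral_vol_eq, h0, h1] at hab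
  have e1 : ∫ x, u x * deriv v x ∂vol = ∫ x, u x * h x ∂vol :=
    integral_congr_ae (hh.mono fun x hx => by simp only [hx])
  have e2 : ∫ x, deriv u x * v x ∂vol = ∫ x, g x * v x ∂vol :=
    integral_congr_ae (hg.mono fun x hx => by simp only [hx])
  rw [e1, e2] at hab
  rw [hab]
  ring

/-! ### Weak derivatives -/

theorem absolutelyContinuous_testFunction (φ : 𝓓(Dom, ℝ)) :
    AbsolutelyContinuousOnInterval φ 0 1 :=
  ContDiffOn.absolutelyContinuousOnInterval ((φ.contDiff.of_le (by simp)).contDiffOn)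

theorem isWeakDeriv_of_ac {u g : ℝ → ℝ} (hu : AbsolutelyContinuousOnInterval u 0 1)
    (hg : deriv u =ᵐ[vol] g) (hgi : Integrable g vol) : IsWeakDeriv u g := by
  refine ⟨?_, IntegrableOn.locallyIntegrableOn hgi, fun φ =>
    integral_mul_deriv_of_ac hu (absolutelyContinuous_testFunction φ) hg ae_eq_rfl
      (testFunction_eq_zero φ (by simp)) (testFunction_eq_zero φ (by simp))⟩
  have hc := hu.continuousOn
  rw [uIcc_of_le zero_le_one] at hc
  exact (hc.mono Ioo_subset_Icc_self).locallyIntegrableOn measurableSet_Ioo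

theorem isWeakDeriv_prim {g : ℝ → ℝ} (hg : Integrable g vol) : IsWeakDeriv (prim g) g :=
  isWeakDeriv_of_ac (absolutelyContinuous_prim hg) (deriv_prim hg) hg

theorem locallyIntegrableOn_congr {u v : ℝ → ℝ} (hu : LocallyIntegrableOn u (Ioo 0 1))
    (h : u =ᵐ[vol] v) : LocallyIntegrableOn v (Ioo 0 1) := fun x hx => by
  obtain ⟨t, ht, hi⟩ := hu x hx
  refine ⟨t ∩ Ioo 0 1, inter_mem ht self_mem_nhdsWithin, ?_⟩
  refine (hi.mono_set inter_subset_left).congr ?_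
  exact ae_restrict_of_ae_restrict_of_subset inter_subset_right h

theorem IsWeakDeriv.congr {u v u' v' : ℝ → ℝ} (h : IsWeakDeriv u v) (hu : u =ᵐ[vol] u')
    (hv : v =ᵐ[vol] v') : IsWeakDeriv u' v' := by
  refine ⟨locallyIntegrableOn_congr h.1 hu, locallyIntegrableOn_congr h.2.1 hv, fun φ => ?_⟩
  have e1 : ∫ x, u' x * deriv φ x ∂vol = ∫ x, u x * deriv φ x ∂vol :=
    integral_congr_ae (hu.mono fun x hx => by simp only [hx])
  have e2 : ∫ x, v' x * φ x ∂vol = ∫ x, v x * φ x ∂vol :=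
    integral_congr_ae (hv.mono fun x hx => by simp only [hx])
  rw [e1, e2, h.2.2 φ]

theorem integrable_mul_testFunction {v : ℝ → ℝ} (hv : LocallyIntegrableOn v (Ioo 0 1))
    (φ : 𝓓(Dom, ℝ)) : Integrable (fun x => v x * φ x) := by
  have h1 : IntegrableOn v (tsupport φ) :=
    hv.integrableOn_compact_subset φ.tsupport_subset φ.hasCompactSupport
  have h2 : IntegrableOn (fun x => v x * φ x) (tsupport φ) :=
    h1.mul_continuousOn φ.continuous.continuousOn φ.hasCompactSupport
  refine (integrableOn_iff_integrable_of_support_subset fun x hx => ?_).1 h2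
  exact subset_tsupport _ (right_ne_zero_of_mul hx)

theorem IsWeakDeriv.unique {u v w : ℝ → ℝ} (hv : IsWeakDeriv u v) (hw : IsWeakDeriv u w) :
    v =ᵐ[vol] w := by
  have key := isOpen_Ioo.ae_eq_zero_of_integral_contDiff_smul_eq_zero (hv.2.1.sub hw.2.1)
    (fun g hg hc hs => by
      let φ : 𝓓(Dom, ℝ) := ⟨g, hg, hc, hs⟩
      have h1 : ∫ x, v x * φ x ∂vol = ∫ x, w x * φ x ∂vol := by
        rw [← neg_inj, ← hv.2.2 φ, ← hw.2.2 φ]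
      have e (r : ℝ → ℝ) : ∫ x, r x * φ x ∂vol = ∫ x, r x * φ x :=
        setIntegral_eq_integral_of_forall_compl_eq_zero fun x hx => by
          rw [testFunction_eq_zero φ hx, mul_zero]
      rw [e, e, ← sub_eq_zero, ← integral_sub (integrable_mul_testFunction hv.2.1 φ)
        (integrable_mul_testFunction hw.2.1 φ)] at h1
      rw [← h1]
      refine integral_congr_ae (Eventually.of_forall fun x => ?_)
      change g x * (v x - w x) = v x * g x - w x * g x
      ring)
  rw [EventuallyEq, ae_restrict_iff' measurableSet_Ioo]
  filter_upwards [key] with x hx hxm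
  exact sub_eq_zero.1 (hx hxm)

theorem isWeakDeriv_weakDeriv {u v : ℝ → ℝ} (h : IsWeakDeriv u v) :
    IsWeakDeriv u (weakDeriv u) := by
  have h' : ∃ v, IsWeakDeriv u v := ⟨v, h⟩
  rw [weakDeriv, dif_pos h']
  exact h'.choose_spec

theorem IsWeakDeriv.weakDeriv_ae_eq {u v : ℝ → ℝ} (h : IsWeakDeriv u v) :
    weakDeriv u =ᵐ[vol] v := (isWeakDeriv_weakDeriv h).unique h

theorem MemW.weakDeriv {k : ℕ} {p : ℝ≥0∞} {u : ℝ → ℝ} (h : MemW (k + 1) p u) :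
    ∃ v, IsWeakDeriv u v ∧ MemW k p v ∧ weakDeriv u =ᵐ[vol] v := by
  obtain ⟨-, v, hv, hvk⟩ := h
  exact ⟨v, hv, hvk, hv.weakDeriv_ae_eq⟩

/-! ### The space `H¹₀(Ω)` -/

theorem testFunction_support (ψ : 𝓓(Dom, ℝ)) :
    ∃ a b : ℝ, 0 < a ∧ a ≤ b ∧ b < 1 ∧ ∀ x ∉ Icc a b, ψ x = 0 := by
  -- The extra point keeps `K` nonempty when `ψ = 0`, so that its infimum and supremum lie in `K`.
  let K := insert (1 / 2 : ℝ) (tsupport ψ)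
  have hK : IsCompact K := IsCompact.insert ψ.hasCompactSupport _
  have hne : K.Nonempty := ⟨_, mem_insert _ _⟩
  have hsub : K ⊆ Ioo 0 1 := insert_subset (by norm_num) ψ.tsupport_subset
  refine ⟨sInf K, sSup K, (hsub (hK.sInf_mem hne)).1, ?_, (hsub (hK.sSup_mem hne)).2,
    fun x hx => image_eq_zero_of_notMem_tsupport fun h => hx ?_⟩
  · exact csInf_le_csSup hne hK.bddBelow hK.bddAbove
  · exact ⟨csInf_le hK.bddBelow (mem_insert_of_mem _ h),
      le_csSup hK.bddAbove (mem_insert_of_mem _ h)⟩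

/-- The primitive vanishes to the left of the support because it starts at `0`, and to the right of
it because the total integral is zero. -/
theorem exists_deriv_eq (ψ : 𝓓(Dom, ℝ)) (h : ∫ x, ψ x ∂vol = 0) :
    ∃ φ : 𝓓(Dom, ℝ), deriv φ = ψ := by
  obtain ⟨a, b, ha, hab, hb, h0⟩ := testFunction_support ψ
  have hd : ∀ x, HasDerivAt (prim ψ) (ψ x) x := fun x =>
    intervalIntegral.integral_hasDerivAt_right (ψ.continuous.intervalIntegrable _ _)
      (ψ.continuous.stronglyMeasurableAtFilter _ _) ψ.continuous.continuousAt
  have hderiv : deriv (prim ψ) = ψ := funext fun x => (hd x).deriv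
  have hs : ContDiff ℝ ∞ (prim ψ) :=
    contDiff_infty_iff_deriv.2 ⟨fun x => (hd x).differentiableAt, by
      rw [hderiv]
      exact ψ.contDiff⟩
  refine ⟨mkTest (prim ψ) hs a b ha hb fun x hx => ?_, hderiv⟩
  rw [mem_Icc, not_and_or, not_le, not_le] at hx
  have hi (s t : ℝ) : IntervalIntegrable ψ volume s t := ψ.continuous.intervalIntegrable _ _
  rcases hx with hx | hx
  · refine intervalIntegral.integral_zero_ae (Eventually.of_forall fun t ht => h0 t fun ht' => ?_)
    have := (uIoc_subset_uIcc ht).2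
    have h2 : max 0 x < a := max_lt ha hx
    exact absurd ht'.1 (not_le.2 (this.trans_lt h2))
  · have h1 : prim ψ x = (∫ t in (0 : ℝ)..1, ψ t) + ∫ t in (1 : ℝ)..x, ψ t :=
      (intervalIntegral.integral_add_adjacent_intervals (hi _ _) (hi _ _)).symm
    rw [h1, ← integral_vol_eq, h, zero_add]
    refine intervalIntegral.integral_zero_ae (Eventually.of_forall fun t ht => h0 t fun ht' => ?_)
    have := (uIoc_subset_uIcc ht).1
    have h2 : b < min 1 x := lt_min hb hx
    exact absurd ht'.2 (not_le.2 (h2.trans_le this))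

/-- A smooth approximation `g` need not be supported in `Ω`; multiplying by `bump` repairs this, and
the error tends to zero in `L²` with majorant `g²`. -/
theorem exists_testFunction_nrm_lt {f : ℝ → ℝ} (hf : MemLp f 2 vol) {ε : ℝ} (hε : 0 < ε) :
    ∃ φ : 𝓓(Dom, ℝ), nrm (f - φ) < ε := by
  obtain ⟨g, -, hgs, hg⟩ := hf.exist_eLpNorm_sub_le (by simp) (by norm_num) (half_pos hε)
  have hgc : Continuous g := hgs.continuous
  have hgm : MemLp g 2 vol := memLp_of_continuousOn hgc.continuousOn 2
  let ψ (n : ℕ) : 𝓓(Dom, ℝ) :=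
    mkTest (fun x => g x * bump 0 1 (n + 1) x) (hgs.mul (contDiff_bump _ _ _))
      (0 + 1 / (n + 1 : ℝ)) (1 - 1 / (n + 1 : ℝ)) (by positivity)
      (by have : (0 : ℝ) < 1 / (n + 1 : ℝ) := by positivity
          linarith) fun x hx => by rw [bump_eq_zero hx, mul_zero]
  have hlim : Tendsto (fun n => nrm (g - ψ n) ^ 2) atTop (𝓝 0) := by
    have h1 (n : ℕ) : nrm (g - ψ n) ^ 2 = ∫ x, (g x - ψ n x) * (g x - ψ n x) ∂vol :=
      nrm_sq (hgm.sub (memLp_testFunction _ _))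
    simp_rw [h1]
    have h2 : (0 : ℝ) = ∫ x, (0 : ℝ) ∂vol := by simp
    rw [h2]
    refine tendsto_integral_of_dominated_convergence (fun x => g x * g x) (fun n => ?_) ?_
      (fun n => Eventually.of_forall fun x => ?_) ?_
    · exact Continuous.aestronglyMeasurable (((hgc.sub (ψ n).continuous).mul
        (hgc.sub (ψ n).continuous)))
    · exact hgm.integrable_mul hgm
    · have e : g x - ψ n x = g x * (1 - bump 0 1 (n + 1) x) := by
        simp only [ψ, mkTest_apply]
        ring
      have h3 := bump_nonneg 0 1 (n + 1) x
      have h4 := bump_le_one 0 1 (n + 1) x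
      have h5 : (1 - bump 0 1 (n + 1) x) * (1 - bump 0 1 (n + 1) x) ≤ 1 :=
        mul_le_one₀ (by linarith) (by linarith) (by linarith)
      rw [e, Real.norm_of_nonneg (mul_self_nonneg _), mul_mul_mul_comm]
      exact mul_le_of_le_one_right (mul_self_nonneg _) h5
    · filter_upwards [ae_vol_mem] with x hx
      have h6 := tendsto_bump 0 1 x
      rw [indicator_of_mem hx] at h6
      have h7 := ((h6.const_mul (g x)).const_sub (g x))
      simpa [ψ] using h7.mul h7
  have hev := hlim.eventually (gt_mem_nhds (show (0 : ℝ) < (ε / 2) ^ 2 by positivity))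
  obtain ⟨n, hn⟩ := hev.exists
  refine ⟨ψ n, ?_⟩
  have h1 : nrm (g - ψ n) < ε / 2 := lt_of_pow_lt_pow_left₀ 2 (by positivity) hn
  have h2 : nrm (f - g) ≤ ε / 2 := ENNReal.toReal_le_of_le_ofReal (by positivity) hg
  have h3 := nrm_add_le (hf.sub hgm) (hgm.sub (memLp_testFunction (ψ n) 2))
  rw [sub_add_sub_cancel] at h3
  linarith

theorem exists_testFunction_integral_eq_one : ∃ ρ : 𝓓(Dom, ℝ), ∫ x, ρ x ∂vol = 1 := by
  have h1 : MemLp (fun _ : ℝ => (1 : ℝ)) 2 vol := memLp_const 1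
  obtain ⟨φ, hφ⟩ := exists_testFunction_nrm_lt h1 one_pos
  have h2 := (abs_integral_le_nrm (h1.sub (memLp_testFunction φ 2))).trans_lt hφ
  have h3 : ∫ x, ((fun _ : ℝ => (1 : ℝ)) - φ) x ∂vol = 1 - ∫ x, φ x ∂vol := by
    have := integral_sub (μ := vol) (integrable_const (1 : ℝ))
      (integrable_of_memLp_two (memLp_testFunction φ 2))
    simpa using this
  rw [h3, abs_lt] at h2
  refine ⟨(∫ x, φ x ∂vol)⁻¹ • φ, ?_⟩
  have h4 : ∫ x, φ x ∂vol ≠ 0 := by linarith [h2.2] |> ne_of_gt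
  change ∫ x, (∫ x, φ x ∂vol)⁻¹ * φ x ∂vol = 1
  rw [integral_const_mul, inv_mul_cancel₀ h4]

/-- A fixed test function of integral `1`. -/
noncomputable def unitTest : 𝓓(Dom, ℝ) := exists_testFunction_integral_eq_one.choose

theorem integral_unitTest : ∫ x, unitTest x ∂vol = 1 :=
  exists_testFunction_integral_eq_one.choose_spec

theorem exists_deriv_eq_sub (ψ : 𝓓(Dom, ℝ)) :
    ∃ φ : 𝓓(Dom, ℝ), deriv φ = fun x => ψ x - (∫ x, ψ x ∂vol) * unitTest x := by
  have h : ∫ x, (ψ - (∫ x, ψ x ∂vol) • unitTest) x ∂vol = 0 := by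
    change ∫ x, ψ x - (∫ x, ψ x ∂vol) * unitTest x ∂vol = 0
    rw [integral_sub (integrable_of_memLp_two (memLp_testFunction ψ 2))
      ((integrable_of_memLp_two (memLp_testFunction unitTest 2)).const_mul _),
      integral_const_mul, integral_unitTest, mul_one, sub_self]
  obtain ⟨φ, hφ⟩ := exists_deriv_eq _ h
  exact ⟨φ, hφ⟩

theorem nrm_smul (c : ℝ) (f : ℝ → ℝ) : nrm (c • f) = |c| * nrm f := by
  rw [nrm, eLpNorm_const_smul, ENNReal.toReal_mul, nrm]
  simp

/-- Since `g` has mean zero, the mean of an approximation `ψ` is at most `nrm (g - ψ)`. Removing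
that mean with `unitTest` makes `ψ` a derivative and enlarges the error by at most the factor `1 +
nrm unitTest`. -/
theorem exists_testFunction_deriv_nrm_lt {g : ℝ → ℝ} (hg : MemLp g 2 vol)
    (h0 : ∫ x, g x ∂vol = 0) {ε : ℝ} (hε : 0 < ε) :
    ∃ φ : 𝓓(Dom, ℝ), nrm (g - deriv φ) < ε := by
  have hN : 0 < 1 + nrm unitTest := by linarith [nrm_nonneg unitTest]
  obtain ⟨ψ, hψ⟩ := exists_testFunction_nrm_lt hg (div_pos hε hN)
  obtain ⟨φ, hφ⟩ := exists_deriv_eq_sub ψ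
  refine ⟨φ, ?_⟩
  have hψm := memLp_testFunction ψ 2
  have hc : |∫ x, ψ x ∂vol| ≤ nrm (g - ψ) := by
    have h1 := abs_integral_le_nrm (hg.sub hψm)
    have h2 : ∫ x, (g - ⇑ψ) x ∂vol = -∫ x, ψ x ∂vol := by
      have := integral_sub (integrable_of_memLp_two hg) (integrable_of_memLp_two hψm)
      rw [h0, zero_sub] at this
      exact this
    rwa [h2, abs_neg] at h1
  have e : g - deriv φ = (g - ψ) + (∫ x, ψ x ∂vol) • unitTest := by
    ext x
    rw [hφ]
    simp only [Pi.sub_apply, Pi.add_apply]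
    change _ = g x - ψ x + (∫ x, ψ x ∂vol) * unitTest x
    ring
  have h3 := nrm_add_le (hg.sub hψm) ((memLp_testFunction unitTest 2).const_smul (∫ x, ψ x ∂vol))
  rw [nrm_smul] at h3
  rw [e]
  refine (h3.trans ?_).trans_lt ((lt_div_iff₀ hN).1 hψ)
  have := mul_le_mul_of_nonneg_right hc (nrm_nonneg unitTest)
  change nrm (g - ⇑ψ) + _ ≤ _
  linarith

theorem MemH10.weakDeriv_spec {u : ℝ → ℝ} (hu : MemH10 u) :
    IsWeakDeriv u (weakDeriv u) ∧ MemLp (weakDeriv u) 2 vol := by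
  obtain ⟨v, hv, hvm, hae⟩ := hu.1.weakDeriv
  exact ⟨isWeakDeriv_weakDeriv hv, (memLp_congr_ae hae).2 hvm⟩

theorem MemH10.memLp {u : ℝ → ℝ} (hu : MemH10 u) : MemLp u 2 vol := hu.1.1

theorem nrm_prim_le {g : ℝ → ℝ} (hg : MemLp g 2 vol) : nrm (prim g) ≤ nrm g :=
  nrm_le_of_bound (nrm_nonneg g) (ae_vol_mem_Icc.mono fun _ hx => abs_prim_le_nrm hg hx)

theorem memLp_prim {g : ℝ → ℝ} (hg : Integrable g vol) (p : ℝ≥0∞) : MemLp (prim g) p vol :=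
  memLp_of_continuousOn (continuousOn_prim hg) p

theorem MemH10.exists_approx {u : ℝ → ℝ} (hu : MemH10 u) {ε : ℝ} (hε : 0 < ε) :
    ∃ φ : 𝓓(Dom, ℝ), nrm (u - φ) < ε ∧ nrm (weakDeriv u - deriv φ) < ε := by
  obtain ⟨φ, h1, h2⟩ := hu.2 (ENNReal.ofReal ε) (by simpa)
  refine ⟨φ, ?_, ?_⟩
  · exact (ENNReal.toReal_lt_of_lt_ofReal h1)
  · exact (ENNReal.toReal_lt_of_lt_ofReal h2)

/-- Derivatives of test functions have mean zero, and the mean is continuous in `L²`. Together with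
`MemH10.ae_eq_prim` this encodes both boundary conditions. -/
theorem MemH10.integral_weakDeriv {u : ℝ → ℝ} (hu : MemH10 u) :
    ∫ x, weakDeriv u x ∂vol = 0 := by
  have hm := hu.weakDeriv_spec.2
  rw [← abs_eq_zero]
  refine le_antisymm (le_of_forall_pos_le_add fun ε hε => ?_) (abs_nonneg _)
  obtain ⟨φ, -, h⟩ := hu.exists_approx hε
  have h1 := abs_integral_le_nrm (hm.sub (memLp_testFunction_deriv φ 2))
  have h2 : ∫ x, (weakDeriv u - deriv φ) x ∂vol = ∫ x, weakDeriv u x ∂vol := by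
    have := integral_sub (integrable_of_memLp_two hm)
      (integrable_of_memLp_two (memLp_testFunction_deriv φ 2))
    rw [integral_deriv_testFunction, sub_zero] at this
    exact this
  rw [h2] at h1
  linarith

theorem ae_eq_zero_of_nrm {f : ℝ → ℝ} (hf : MemLp f 2 vol) (h : nrm f = 0) : f =ᵐ[vol] 0 := by
  rw [nrm, ENNReal.toReal_eq_zero_iff] at h
  exact (eLpNorm_eq_zero_iff hf.1 (by simp)).1 (h.resolve_right hf.2.ne)

/-- A test function is the primitive of its derivative, and `prim` is bounded from `L²` to the sup
norm, so the identity passes to the limit. -/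
theorem MemH10.ae_eq_prim {u : ℝ → ℝ} (hu : MemH10 u) : u =ᵐ[vol] prim (weakDeriv u) := by
  have hm := hu.weakDeriv_spec.2
  have hp := memLp_prim (integrable_of_memLp_two hm) 2
  refine (sub_ae_eq_zero _ _).1 (ae_eq_zero_of_nrm (hu.memLp.sub hp) ?_)
  refine le_antisymm (le_of_forall_pos_le_add fun ε hε => ?_) (nrm_nonneg _)
  obtain ⟨φ, h1, h2⟩ := hu.exists_approx (half_pos hε)
  have hd := memLp_testFunction_deriv φ 2
  have hφ := memLp_testFunction φ 2
  have h3 := nrm_add_le (hu.memLp.sub hφ) (hφ.sub hp)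
  rw [sub_add_sub_cancel] at h3
  have h4 : nrm (φ - prim (weakDeriv u)) ≤ nrm (weakDeriv u - deriv φ) := by
    refine nrm_le_of_bound (nrm_nonneg _) (ae_vol_mem_Icc.mono fun x hx => ?_)
    have h5 := abs_prim_le_nrm (hm.sub hd) hx
    rwa [prim_sub (integrable_of_memLp_two hm) (integrable_of_memLp_two hd) hx,
      prim_deriv_testFunction, abs_sub_comm] at h5
  linarith

/-- Approximating `g` by derivatives of test functions suffices: the bound on `prim` controls the
functions themselves with the same error. -/
theorem memH10_of_prim {u g : ℝ → ℝ} (hg : MemLp g 2 vol) (h0 : ∫ x, g x ∂vol = 0)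
    (hu : u =ᵐ[vol] prim g) : MemH10 u ∧ weakDeriv u =ᵐ[vol] g := by
  have hgi := integrable_of_memLp_two hg
  have hw : IsWeakDeriv u g := (isWeakDeriv_prim hgi).congr hu.symm ae_eq_rfl
  have hae := hw.weakDeriv_ae_eq
  have hum : MemLp u 2 vol := (memLp_congr_ae hu).2 (memLp_prim hgi 2)
  refine ⟨⟨⟨hum, g, hw, hg⟩, fun ε hε => ?_⟩, hae⟩
  obtain ⟨δ, hδ, hδε⟩ : ∃ δ : ℝ, 0 < δ ∧ ENNReal.ofReal δ ≤ ε := by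
    obtain ⟨r, hr0, hr⟩ := ENNReal.lt_iff_exists_nnreal_btwn.1 hε
    exact ⟨r, by simpa using hr0, by simpa using hr.le⟩
  obtain ⟨φ, hφ⟩ := exists_testFunction_deriv_nrm_lt hg h0 hδ
  have hd := memLp_testFunction_deriv φ 2
  have h1 : nrm (u - φ) < δ := by
    refine lt_of_le_of_lt (nrm_le_of_bound (nrm_nonneg _) ?_) hφ
    filter_upwards [hu, ae_vol_mem_Icc] with x hx hxm
    have h5 := abs_prim_le_nrm (hg.sub hd) hxm
    rwa [prim_sub hgi (integrable_of_memLp_two hd) hxm, prim_deriv_testFunction, ← hx] at h5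
  refine ⟨φ, lt_of_lt_of_le ?_ hδε, lt_of_lt_of_le ?_ hδε⟩
  · have h3 := ofReal_nrm (hum.sub (memLp_testFunction φ 2))
    refine lt_of_eq_of_lt h3.symm ?_
    exact (ENNReal.ofReal_lt_ofReal_iff hδ).2 h1
  · have h2 : (fun x => weakDeriv u x - deriv φ x) =ᵐ[vol] g - deriv φ := by
      filter_upwards [hae] with x hx
      simp [hx]
    rw [eLpNorm_congr_ae h2, ← ofReal_nrm (hg.sub hd)]
    exact (ENNReal.ofReal_lt_ofReal_iff hδ).2 hφ

/-! ### The bilinear form -/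

/-- Coefficients of a coercive form: `a` is continuous with `a ≥ ν > 0`, and `0 ≤ d₀ ∈ L^∞(Ω)`. -/
structure IsCoercivePair (ν : ℝ) (a d₀ : ℝ → ℝ) : Prop where
  pos : 0 < ν
  continuousOn : ContinuousOn a (Icc 0 1)
  lower : ∀ x ∈ Icc (0 : ℝ) 1, ν ≤ a x
  memLp : MemLp d₀ ∞ vol
  nonneg : ∀ᵐ x ∂vol, 0 ≤ d₀ x

theorem ae_bound_of_memLp_top {f : ℝ → ℝ} (hf : MemLp f ∞ vol) :
    ∃ C, 0 ≤ C ∧ ∀ᵐ x ∂vol, |f x| ≤ C := by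
  refine ⟨(eLpNormEssSup f vol).toReal, ENNReal.toReal_nonneg, ?_⟩
  have hfin : eLpNormEssSup f vol ≠ (⊤ : ℝ≥0∞) := by
    have := hf.2.ne
    rwa [eLpNorm_exponent_top] at this
  filter_upwards [ae_le_eLpNormEssSup (f := f) (μ := vol)] with x hx
  have := ENNReal.toReal_mono hfin hx
  simpa using this

theorem abs_integral_mul_le {f g : ℝ → ℝ} (hf : MemLp f 2 vol) (hg : MemLp g 2 vol) :
    |∫ x, f x * g x ∂vol| ≤ nrm f * nrm g := by
  have h := abs_real_inner_le_norm (hf.toLp f) (hg.toLp g)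
  rw [L2.inner_def, Lp.norm_toLp, Lp.norm_toLp] at h
  have e : ∫ x, inner ℝ (hf.toLp f x) (hg.toLp g x) ∂vol = ∫ x, f x * g x ∂vol := by
    refine integral_congr_ae ?_
    filter_upwards [hf.coeFn_toLp, hg.coeFn_toLp] with x h1 h2
    rw [h1, h2]
    simp [mul_comm]
  rwa [e] at h

/-- The bilinear form in terms of the derivatives. -/
noncomputable def form (a d₀ g h : ℝ → ℝ) : ℝ :=
  pairing (fun x => a x * g x) h + pairing (fun x => d₀ x * prim g x) (prim h)

theorem form_congr {a d₀ g g' h h' : ℝ → ℝ} (hg : g =ᵐ[vol] g') (hh : h =ᵐ[vol] h') :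
    form a d₀ g h = form a d₀ g' h' := by
  unfold form pairing
  congr 1
  · refine integral_congr_ae ?_
    filter_upwards [hg, hh] with x h1 h2
    rw [h1, h2]
  · refine integral_congr_ae ?_
    filter_upwards [ae_vol_mem_Icc] with x hx
    rw [prim_congr hg hx, prim_congr hh hx]

theorem form_comm (a d₀ g h : ℝ → ℝ) : form a d₀ g h = form a d₀ h g := by
  unfold form pairing
  congr 1 <;> exact integral_congr_ae (Eventually.of_forall fun x => by ring)

theorem bilin_comm (a d₀ v w : ℝ → ℝ) : bilin a d₀ v w = bilin a d₀ w v := by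
  unfold bilin pairing
  congr 1 <;> exact integral_congr_ae (Eventually.of_forall fun x => by ring)

theorem pairing_comm (f g : ℝ → ℝ) : pairing f g = pairing g f := by
  unfold pairing
  simp_rw [mul_comm]

theorem bilin_eq_form {a d₀ u v g h : ℝ → ℝ} (hg : weakDeriv u =ᵐ[vol] g)
    (hh : weakDeriv v =ᵐ[vol] h) (hu : u =ᵐ[vol] prim g) (hv : v =ᵐ[vol] prim h) :
    bilin a d₀ u v = form a d₀ g h := by
  unfold bilin form pairing
  congr 1
  · refine integral_congr_ae ?_
    filter_upwards [hg, hh] with x h1 h2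
    rw [h1, h2]
  · refine integral_congr_ae ?_
    filter_upwards [hu, hv] with x h1 h2
    rw [h1, h2]

theorem MemH10.bilin_eq {a d₀ u v : ℝ → ℝ} (hu : MemH10 u) (hv : MemH10 v) :
    bilin a d₀ u v = form a d₀ (weakDeriv u) (weakDeriv v) :=
  bilin_eq_form ae_eq_rfl ae_eq_rfl hu.ae_eq_prim hv.ae_eq_prim

variable {ν : ℝ} {a d₀ : ℝ → ℝ}

theorem memLp_mul_bounded {f g : ℝ → ℝ} (hf : AEStronglyMeasurable f vol) {C : ℝ}
    (hC : ∀ᵐ x ∂vol, |f x| ≤ C) (hg : MemLp g 2 vol) : MemLp (fun x => f x * g x) 2 vol :=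
  MemLp.of_le_mul (c := C) hg (hf.mul hg.1) (hC.mono fun x hx => by
    rw [norm_mul]
    exact mul_le_mul_of_nonneg_right hx (norm_nonneg _))

theorem nrm_mul_le {f g : ℝ → ℝ} {C : ℝ} (hC0 : 0 ≤ C)
    (hC : ∀ᵐ x ∂vol, |f x| ≤ C) (hg : MemLp g 2 vol) :
    nrm (fun x => f x * g x) ≤ C * nrm g := by
  have h := eLpNorm_le_mul_eLpNorm_of_ae_le_mul (p := 2) (μ := vol) (f := fun x => f x * g x)
    (g := g) (c := C) (hC.mono fun x hx => by
      rw [norm_mul]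
      exact mul_le_mul_of_nonneg_right hx (norm_nonneg _))
  have h2 := ENNReal.toReal_mono (ENNReal.mul_ne_top ENNReal.ofReal_ne_top hg.2.ne) h
  rwa [ENNReal.toReal_mul, ENNReal.toReal_ofReal hC0] at h2

theorem IsCoercivePair.aestronglyMeasurable (hc : IsCoercivePair ν a d₀) :
    AEStronglyMeasurable a vol := (memLp_of_continuousOn hc.continuousOn 2).1

theorem IsCoercivePair.exists_bound (hc : IsCoercivePair ν a d₀) :
    ∃ A, 0 ≤ A ∧ ∀ᵐ x ∂vol, |a x| ≤ A :=
  ae_bound_of_memLp_top (memLp_of_continuousOn hc.continuousOn ∞)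

theorem IsCoercivePair.memLp_mul (hc : IsCoercivePair ν a d₀) {g : ℝ → ℝ} (hg : MemLp g 2 vol) :
    MemLp (fun x => a x * g x) 2 vol := by
  obtain ⟨A, -, hA⟩ := hc.exists_bound
  exact memLp_mul_bounded hc.aestronglyMeasurable hA hg

theorem IsCoercivePair.memLp_mul' (hc : IsCoercivePair ν a d₀) {g : ℝ → ℝ} (hg : MemLp g 2 vol) :
    MemLp (fun x => d₀ x * g x) 2 vol := by
  obtain ⟨A, -, hA⟩ := ae_bound_of_memLp_top hc.memLp
  exact memLp_mul_bounded hc.memLp.1 hA hg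

theorem memLp_prim_two {g : ℝ → ℝ} (hg : MemLp g 2 vol) : MemLp (prim g) 2 vol :=
  memLp_prim (integrable_of_memLp_two hg) 2

theorem integrable_mul_two {f g : ℝ → ℝ} (hf : MemLp f 2 vol) (hg : MemLp g 2 vol) :
    Integrable (fun x => f x * g x) vol := hf.integrable_mul hg

theorem form_add_left (hc : IsCoercivePair ν a d₀) {g g' h : ℝ → ℝ} (hg : MemLp g 2 vol)
    (hg' : MemLp g' 2 vol) (hh : MemLp h 2 vol) :
    form a d₀ (g + g') h = form a d₀ g h + form a d₀ g' h := by
  unfold form pairing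
  have e1 : ∫ x, a x * (g + g') x * h x ∂vol =
      (∫ x, a x * g x * h x ∂vol) + ∫ x, a x * g' x * h x ∂vol := by
    rw [← integral_add (integrable_mul_two (hc.memLp_mul hg) hh)
      (integrable_mul_two (hc.memLp_mul hg') hh)]
    refine integral_congr_ae (Eventually.of_forall fun x => ?_)
    simp only [Pi.add_apply]
    ring
  have e2 : ∫ x, d₀ x * prim (g + g') x * prim h x ∂vol =
      (∫ x, d₀ x * prim g x * prim h x ∂vol) + ∫ x, d₀ x * prim g' x * prim h x ∂vol := by
    rw [← integral_add (integrable_mul_two (hc.memLp_mul' (memLp_prim_two hg))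
      (memLp_prim_two hh)) (integrable_mul_two (hc.memLp_mul' (memLp_prim_two hg'))
      (memLp_prim_two hh))]
    refine integral_congr_ae ?_
    filter_upwards [ae_vol_mem_Icc] with x hx
    rw [prim_add (integrable_of_memLp_two hg) (integrable_of_memLp_two hg') hx]
    ring
  rw [e1, e2]
  ring

theorem form_smul_left (c : ℝ) (g h : ℝ → ℝ) :
    form a d₀ (c • g) h = c * form a d₀ g h := by
  unfold form pairing
  have e1 : ∫ x, a x * (c • g) x * h x ∂vol = c * ∫ x, a x * g x * h x ∂vol := by
    rw [← integral_const_mul]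
    refine integral_congr_ae (Eventually.of_forall fun x => ?_)
    simp only [Pi.smul_apply, smul_eq_mul]
    ring
  have e2 : ∫ x, d₀ x * prim (c • g) x * prim h x ∂vol =
      c * ∫ x, d₀ x * prim g x * prim h x ∂vol := by
    rw [← integral_const_mul]
    refine integral_congr_ae (Eventually.of_forall fun x => ?_)
    simp only [prim_smul]
    ring
  rw [e1, e2]
  ring

theorem form_add_right (hc : IsCoercivePair ν a d₀) {g h h' : ℝ → ℝ} (hg : MemLp g 2 vol)
    (hh : MemLp h 2 vol) (hh' : MemLp h' 2 vol) :
    form a d₀ g (h + h') = form a d₀ g h + form a d₀ g h' := by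
  rw [form_comm, form_add_left hc hh hh' hg, form_comm a d₀ h, form_comm a d₀ h']

theorem form_smul_right (c : ℝ) (g h : ℝ → ℝ) :
    form a d₀ g (c • h) = c * form a d₀ g h := by
  rw [form_comm, form_smul_left, form_comm]

theorem IsCoercivePair.exists_form_bound (hc : IsCoercivePair ν a d₀) :
    ∃ C, ∀ g h : ℝ → ℝ, MemLp g 2 vol → MemLp h 2 vol → |form a d₀ g h| ≤ C * nrm g * nrm h := by
  obtain ⟨A, hA0, hA⟩ := hc.exists_bound
  obtain ⟨D, hD0, hD⟩ := ae_bound_of_memLp_top hc.memLp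
  refine ⟨A + D, fun g h hg hh => ?_⟩
  have h1 := abs_integral_mul_le (hc.memLp_mul hg) hh
  have h2 := abs_integral_mul_le (hc.memLp_mul' (memLp_prim_two hg)) (memLp_prim_two hh)
  have h3 := mul_le_mul_of_nonneg_right (nrm_mul_le hA0 hA hg) (nrm_nonneg h)
  have h4 : nrm (fun x => d₀ x * prim g x) * nrm (prim h) ≤ D * nrm g * nrm h :=
    mul_le_mul ((nrm_mul_le hD0 hD (memLp_prim_two hg)).trans
      (mul_le_mul_of_nonneg_left (nrm_prim_le hg) hD0)) (nrm_prim_le hh) (nrm_nonneg _)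
      (mul_nonneg hD0 (nrm_nonneg _))
  unfold form pairing
  calc _ ≤ _ := abs_add_le _ _
    _ ≤ A * nrm g * nrm h + D * nrm g * nrm h := add_le_add (h1.trans h3) (h2.trans h4)
    _ = _ := by ring

/-- The norm of the derivative serves as the norm on `V`, so coercivity needs no Poincaré
inequality: the zero-order term is simply dropped. -/
theorem IsCoercivePair.le_form (hc : IsCoercivePair ν a d₀) {g : ℝ → ℝ} (hg : MemLp g 2 vol) :
    ν * nrm g ^ 2 ≤ form a d₀ g g := by
  have h2 : 0 ≤ pairing (fun x => d₀ x * prim g x) (prim g) := by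
    refine integral_nonneg_of_ae (hc.nonneg.mono fun x hx => ?_)
    have := mul_nonneg hx (mul_self_nonneg (prim g x))
    simpa [mul_assoc] using this
  have h1 : ν * nrm g ^ 2 ≤ pairing (fun x => a x * g x) g := by
    rw [nrm_sq hg, ← integral_const_mul]
    refine integral_mono_ae ((integrable_mul_two hg hg).const_mul _)
      (integrable_mul_two (hc.memLp_mul hg) hg) ?_
    filter_upwards [ae_vol_mem_Icc] with x hx
    have := mul_le_mul_of_nonneg_right (hc.lower x hx) (mul_self_nonneg (g x))
    simpa [mul_assoc] using this
  unfold form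
  linarith

/-! ### Solvability -/

/-- Square integrable functions with mean zero. -/
noncomputable def meanZero : Submodule ℝ (Lp ℝ 2 vol) :=
  (Submodule.span ℝ {(memLp_const (1 : ℝ) : MemLp (fun _ : ℝ => (1 : ℝ)) 2 vol).toLp})ᗮ

theorem mem_meanZero (g : Lp ℝ 2 vol) : g ∈ meanZero ↔ ∫ x, g x ∂vol = 0 := by
  rw [meanZero, Submodule.mem_orthogonal_singleton_iff_inner_right, L2.inner_def]
  have : ∫ x, inner ℝ ((memLp_const (1 : ℝ) : MemLp (fun _ : ℝ => (1 : ℝ)) 2 vol).toLp _ x)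
      (g x) ∂vol = ∫ x, g x ∂vol := by
    refine integral_congr_ae ?_
    filter_upwards [(memLp_const (1 : ℝ) : MemLp (fun _ : ℝ => (1 : ℝ)) 2 vol).coeFn_toLp]
      with x hx
    rw [hx]
    simp
  rw [this]

instance instCompleteMeanZero : CompleteSpace meanZero := by
  unfold meanZero
  infer_instance

theorem norm_eq_nrm (g : meanZero) : ‖g‖ = nrm (g : Lp ℝ 2 vol) := rfl

theorem coe_add_ae (g h : meanZero) :
    ((g + h : meanZero) : Lp ℝ 2 vol) =ᵐ[vol] (g : Lp ℝ 2 vol) + (h : Lp ℝ 2 vol) :=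
  Lp.coeFn_add _ _

theorem coe_smul_ae (c : ℝ) (h : meanZero) :
    ((c • h : meanZero) : Lp ℝ 2 vol) =ᵐ[vol] c • ⇑(h : Lp ℝ 2 vol) :=
  Lp.coeFn_smul _ _

theorem memLp_coe (g : meanZero) : MemLp (g : Lp ℝ 2 vol) 2 vol := Lp.memLp _

theorem exists_continuous_form (hc : IsCoercivePair ν a d₀) :
    ∃ B : meanZero →L[ℝ] meanZero →L[ℝ] ℝ, ∀ g h : meanZero,
      B g h = form a d₀ (g : Lp ℝ 2 vol) (h : Lp ℝ 2 vol) := by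
  obtain ⟨C, hC⟩ := hc.exists_form_bound
  let b : meanZero →ₗ[ℝ] meanZero →ₗ[ℝ] ℝ :=
    LinearMap.mk₂ ℝ (fun g h => form a d₀ (g : Lp ℝ 2 vol) (h : Lp ℝ 2 vol))
      (fun g g' h => by
        rw [form_congr (coe_add_ae g g') ae_eq_rfl,
          form_add_left hc (memLp_coe _) (memLp_coe _) (memLp_coe _)])
      (fun c g h => by
        rw [form_congr (coe_smul_ae c g) ae_eq_rfl, form_smul_left, smul_eq_mul])
      (fun g h h' => by
        rw [form_congr ae_eq_rfl (coe_add_ae h h'),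
          form_add_right hc (memLp_coe _) (memLp_coe _) (memLp_coe _)])
      (fun c g h => by
        rw [form_congr ae_eq_rfl (coe_smul_ae c h), form_smul_right, smul_eq_mul])
  exact ⟨b.mkContinuous₂ C fun g h => hC _ _ (memLp_coe g) (memLp_coe h), fun _ _ => rfl⟩

theorem integrable_mul_prim {f : ℝ → ℝ} (hf : Integrable f vol) {h : ℝ → ℝ}
    (hh : Integrable h vol) : Integrable (fun x => f x * prim h x) vol :=
  integrable_mul_bounded hf (memLp_prim hh 2).1
    (ae_vol_mem_Icc.mono fun _ hx => abs_prim_le hh hx)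

/-- Primitives are bounded in the sup norm by the `L²` norm, so `L¹` data are enough. This is the
integrability contained in `MemBV`. -/
theorem exists_continuous_functional {f : ℝ → ℝ} (hf : Integrable f vol) :
    ∃ l : meanZero →L[ℝ] ℝ, ∀ h : meanZero, l h = ∫ x, f x * prim (h : Lp ℝ 2 vol) x ∂vol := by
  let l : meanZero →ₗ[ℝ] ℝ :=
    { toFun := fun h => ∫ x, f x * prim (h : Lp ℝ 2 vol) x ∂vol
      map_add' := fun g h => by
        have hg := integrable_of_memLp_two (memLp_coe g)
        have hh := integrable_of_memLp_two (memLp_coe h)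
        rw [← integral_add (integrable_mul_prim hf hg) (integrable_mul_prim hf hh)]
        refine integral_congr_ae (ae_vol_mem_Icc.mono fun x hx => ?_)
        simp only
        rw [prim_congr (coe_add_ae g h) hx, prim_add hg hh hx, mul_add]
      map_smul' := fun c h => by
        rw [RingHom.id_apply, smul_eq_mul, ← integral_const_mul]
        refine integral_congr_ae (ae_vol_mem_Icc.mono fun x hx => ?_)
        simp only
        rw [prim_congr (coe_smul_ae c h) hx, prim_smul]
        ring }
  refine ⟨l.mkContinuous (∫ x, |f x| ∂vol) fun h => ?_, fun _ => rfl⟩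
  have hh := integrable_of_memLp_two (memLp_coe h)
  change |∫ x, f x * prim (h : Lp ℝ 2 vol) x ∂vol| ≤ _
  refine abs_integral_le_integral_abs.trans ?_
  rw [norm_eq_nrm, ← integral_mul_const]
  refine integral_mono_ae (integrable_mul_prim hf hh).abs (hf.abs.mul_const _)
    (ae_vol_mem_Icc.mono fun x hx => ?_)
  simp only [abs_mul]
  exact mul_le_mul_of_nonneg_left (abs_prim_le_nrm (memLp_coe h) hx) (abs_nonneg _)

/-- Lax–Milgram on `meanZero`, with the functional represented by Riesz. -/
theorem exists_form_eq (hc : IsCoercivePair ν a d₀) {f : ℝ → ℝ} (hf : Integrable f vol) :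
    ∃ g, MemLp g 2 vol ∧ ∫ x, g x ∂vol = 0 ∧ ∀ h, MemLp h 2 vol → ∫ x, h x ∂vol = 0 →
      form a d₀ g h = ∫ x, f x * prim h x ∂vol := by
  obtain ⟨B, hB⟩ := exists_continuous_form hc
  obtain ⟨l, hl⟩ := exists_continuous_functional hf
  have hco : IsCoercive B := ⟨ν, hc.pos, fun g => by
    rw [hB, norm_eq_nrm]
    have := hc.le_form (memLp_coe g)
    rwa [sq, ← mul_assoc] at this⟩
  let g : meanZero :=
    hco.continuousLinearEquivOfBilin.symm ((InnerProductSpace.toDual ℝ meanZero).symm l)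
  refine ⟨(g : Lp ℝ 2 vol), memLp_coe g, (mem_meanZero _).1 g.2, fun h hh h0 => ?_⟩
  have hhm : hh.toLp h ∈ meanZero := by
    rw [mem_meanZero, integral_congr_ae hh.coeFn_toLp, h0]
  have key := hco.continuousLinearEquivOfBilin_apply g ⟨_, hhm⟩
  rw [ContinuousLinearEquiv.apply_symm_apply, InnerProductSpace.toDual_symm_apply, hB, hl] at key
  rw [form_congr (ae_eq_rfl : _ =ᵐ[vol] ⇑(g : Lp ℝ 2 vol)) hh.coeFn_toLp.symm]
  refine key.symm.trans (integral_congr_ae (ae_vol_mem_Icc.mono fun x hx => ?_))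
  simp only
  rw [prim_congr hh.coeFn_toLp hx]

theorem exists_isState (hc : IsCoercivePair ν a d₀) {q : ℝ → ℝ} (hq : Integrable q vol) :
    ∃ u : Fn, IsState a d₀ q u := by
  obtain ⟨g, hg, h0, hgq⟩ := exists_form_eq hc hq
  let u : Fn := AEEqFun.mk (prim g) (memLp_prim_two hg).1
  have hu : u =ᵐ[vol] prim g := AEEqFun.coeFn_mk _ _
  obtain ⟨hu1, hu2⟩ := memH10_of_prim hg h0 hu
  refine ⟨u, hu1, fun w hw => ?_⟩
  rw [bilin_eq_form hu2 ae_eq_rfl hu hw.ae_eq_prim, hgq _ hw.weakDeriv_spec.2 hw.integral_weakDeriv]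
  exact integral_congr_ae (hw.ae_eq_prim.mono fun x hx => by simp only [← hx])

theorem isState_S (hc : IsCoercivePair ν a d₀) {q : ℝ → ℝ} (hq : Integrable q vol) :
    IsState a d₀ q (S a d₀ q) := by
  have h := exists_isState hc hq
  rw [S, dif_pos h]
  exact h.choose_spec

theorem MemH10.lincomb {u v r : ℝ → ℝ} (hu : MemH10 u) (hv : MemH10 v) (c : ℝ)
    (hr : r =ᵐ[vol] c • u + v) :
    MemH10 r ∧ weakDeriv r =ᵐ[vol] c • weakDeriv u + weakDeriv v := by
  have hu2 := hu.weakDeriv_spec.2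
  have hv2 := hv.weakDeriv_spec.2
  refine memH10_of_prim ((hu2.const_smul c).add hv2) ?_ ?_
  · have := integral_add (integrable_of_memLp_two (hu2.const_smul c)) (integrable_of_memLp_two hv2)
    simp only [Pi.smul_apply, smul_eq_mul, integral_const_mul, hu.integral_weakDeriv,
      hv.integral_weakDeriv, mul_zero, add_zero] at this
    exact this
  · filter_upwards [hr, hu.ae_eq_prim, hv.ae_eq_prim, ae_vol_mem_Icc] with x h1 h2 h3 hx
    rw [h1, prim_add (integrable_of_memLp_two (hu2.const_smul c)) (integrable_of_memLp_two hv2) hx,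
      prim_smul, ← h2, ← h3]
    rfl

theorem bilin_lincomb (hc : IsCoercivePair ν a d₀) {u v r w : ℝ → ℝ} (hu : MemH10 u)
    (hv : MemH10 v) (hw : MemH10 w) (c : ℝ) (hr : r =ᵐ[vol] c • u + v) :
    bilin a d₀ r w = c * bilin a d₀ u w + bilin a d₀ v w := by
  obtain ⟨hr1, hr2⟩ := hu.lincomb hv c hr
  rw [hr1.bilin_eq hw, hu.bilin_eq hw, hv.bilin_eq hw, form_congr hr2 ae_eq_rfl,
    form_add_left hc (hu.weakDeriv_spec.2.const_smul c) hv.weakDeriv_spec.2 hw.weakDeriv_spec.2,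
    form_smul_left]

theorem MemH10.integrable_mul {w q : ℝ → ℝ} (hw : MemH10 w) (hq : Integrable q vol) :
    Integrable (fun x => q x * w x) vol :=
  (integrable_mul_prim hq (integrable_of_memLp_two hw.weakDeriv_spec.2)).congr
    (hw.ae_eq_prim.mono fun x hx => by simp only [← hx])

theorem IsState.lincomb (hc : IsCoercivePair ν a d₀) {p q t u v r : ℝ → ℝ}
    (hp : Integrable p vol) (hq : Integrable q vol) (hu : IsState a d₀ p u)
    (hv : IsState a d₀ q v) (c : ℝ) (hr : r =ᵐ[vol] c • u + v) (ht : t =ᵐ[vol] c • p + q) :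
    IsState a d₀ t r := by
  refine ⟨(hu.1.lincomb hv.1 c hr).1, fun w hw => ?_⟩
  rw [bilin_lincomb hc hu.1 hv.1 hw c hr, hu.2 w hw, hv.2 w hw]
  unfold pairing
  rw [← integral_const_mul, ← integral_add ((hw.integrable_mul hp).const_mul c)
    (hw.integrable_mul hq)]
  refine integral_congr_ae (ht.mono fun x hx => ?_)
  simp only [hx, Pi.add_apply, Pi.smul_apply, smul_eq_mul]
  ring

theorem MemH10.ae_eq_zero {u : ℝ → ℝ} (hc : IsCoercivePair ν a d₀) (hu : MemH10 u)
    (h : bilin a d₀ u u = 0) : u =ᵐ[vol] 0 := by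
  have hm := hu.weakDeriv_spec.2
  rw [hu.bilin_eq hu] at h
  have h1 := hc.le_form hm
  rw [h] at h1
  have h2 : nrm (weakDeriv u) = 0 := by
    have h3 : nrm (weakDeriv u) ^ 2 ≤ 0 := nonpos_of_mul_nonpos_right h1 hc.pos
    exact pow_eq_zero_iff (two_ne_zero) |>.1 (le_antisymm h3 (sq_nonneg _))
  filter_upwards [hu.ae_eq_prim, ae_vol_mem_Icc] with x hx hxm
  rw [hx, prim_congr (ae_eq_zero_of_nrm hm h2) hxm]
  simp [prim]

theorem IsState.unique (hc : IsCoercivePair ν a d₀) {q : ℝ → ℝ} (hq : Integrable q vol)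
    {u v : Fn} (hu : IsState a d₀ q u) (hv : IsState a d₀ q v) : u = v := by
  have hr : ⇑(v - u : Fn) =ᵐ[vol] (-1 : ℝ) • ⇑u + ⇑v := by
    filter_upwards [AEEqFun.coeFn_sub v u] with x hx
    rw [hx]
    simp only [Pi.sub_apply, Pi.add_apply, Pi.smul_apply, smul_eq_mul]
    ring
  have hs : IsState a d₀ 0 (v - u : Fn) :=
    IsState.lincomb hc hq hq hu hv (-1) hr (Eventually.of_forall fun x => by simp)
  have h0 : bilin a d₀ (v - u : Fn) (v - u : Fn) = 0 := by
    rw [hs.2 _ hs.1]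
    simp [pairing]
  have h1 := hs.1.ae_eq_zero hc h0
  refine AEEqFun.ext ?_
  filter_upwards [h1, hr] with x h2 h3
  rw [h2] at h3
  simp only [Pi.zero_apply, Pi.add_apply, Pi.smul_apply, smul_eq_mul] at h3
  linarith

/-! ### Regularity of solutions -/

/-- Test with `F` minus its own mean `c`: the result is the squared norm of `F - c`. -/
theorem ae_const_of_orthogonal {F : ℝ → ℝ} (hF : MemLp F 2 vol)
    (h : ∀ g, MemLp g 2 vol → ∫ x, g x ∂vol = 0 → ∫ x, F x * g x ∂vol = 0) :
    ∃ c, F =ᵐ[vol] fun _ => c := by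
  let c := ∫ x, F x ∂vol
  let g : ℝ → ℝ := fun x => F x - c
  have hg : MemLp g 2 vol := hF.sub (memLp_const c)
  have hg0 : ∫ x, g x ∂vol = 0 := by
    have := integral_sub (integrable_of_memLp_two hF) (integrable_const (μ := vol) c)
    simpa [g, c] using this
  have hsq : nrm g ^ 2 = 0 := by
    have e : ∫ x, g x * g x ∂vol = (∫ x, F x * g x ∂vol) - c * ∫ x, g x ∂vol := by
      rw [← integral_const_mul, ← integral_sub (integrable_mul_two hF hg)
        ((integrable_of_memLp_two hg).const_mul c)]
      refine integral_congr_ae (Eventually.of_forall fun x => ?_)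
      simp only [g]
      ring
    rw [nrm_sq hg, e, h g hg hg0, hg0, mul_zero, sub_zero]
  refine ⟨c, ?_⟩
  filter_upwards [ae_eq_zero_of_nrm hg ((pow_eq_zero_iff two_ne_zero).1 hsq)] with x hx
  exact sub_eq_zero.1 hx

theorem abs_prim_sub_le {h : ℝ → ℝ} (hh : Integrable h vol) {C : ℝ} (hC : ∀ᵐ x ∂vol, |h x| ≤ C)
    {x y : ℝ} (hx : x ∈ Icc (0 : ℝ) 1) (hy : y ∈ Icc (0 : ℝ) 1) :
    |prim h x - prim h y| ≤ C * |x - y| := by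
  have e : prim h x - prim h y = ∫ t in y..x, h t :=
    intervalIntegral.integral_interval_sub_left (intervalIntegrable_sub hh (by simp) hx)
      (intervalIntegrable_sub hh (by simp) hy)
  rw [e, ← Real.norm_eq_abs]
  refine intervalIntegral.norm_integral_le_of_norm_le_const_ae ?_
  have h1 := (ae_restrict_iff' measurableSet_Ioo).1 hC
  -- The half-open interval of integration may contain `1`, where the bound on `Ω` says nothing.
  have h2 : ∀ᵐ t : ℝ, t ≠ 1 := by simp [ae_iff, measure_singleton]
  filter_upwards [h1, h2] with t ht ht1 htm
  refine ht ⟨?_, ?_⟩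
  · exact (le_min hy.1 hx.1).trans_lt htm.1
  · exact lt_of_le_of_ne (htm.2.trans (max_le hy.2 hx.2)) ht1

theorem lipschitzOn_div {a H : ℝ → ℝ} {ν : ℝ} (hν : 0 < ν) {L : ℝ≥0}
    (haL : LipschitzOnWith L a (Icc 0 1)) (haν : ∀ x ∈ Icc (0 : ℝ) 1, ν ≤ a x) {C M : ℝ}
    (hM : ∀ x ∈ Icc (0 : ℝ) 1, |H x| ≤ M)
    (hH : ∀ x ∈ Icc (0 : ℝ) 1, ∀ y ∈ Icc (0 : ℝ) 1, |H x - H y| ≤ C * |x - y|) :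
    ∃ K : ℝ≥0, LipschitzOnWith K (fun x => H x / a x) (Icc 0 1) := by
  have hM0 : 0 ≤ M := (abs_nonneg _).trans (hM 0 (by simp))
  have hC0 : 0 ≤ C := by simpa using (abs_nonneg _).trans (hH 1 (by simp) 0 (by simp))
  refine ⟨⟨M * L / (ν * ν) + C / ν, by positivity⟩, LipschitzOnWith.of_dist_le_mul
    fun x hx y hy => ?_⟩
  have hax := hν.trans_le (haν x hx)
  have hay := hν.trans_le (haν y hy)
  have e : H x / a x - H y / a y = H x * (a y - a x) / (a x * a y) + (H x - H y) / a y := by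
    field_simp
    ring
  have hLa : |a y - a x| ≤ L * |x - y| := by
    have := haL.dist_le_mul y hy x hx
    rwa [Real.dist_eq, Real.dist_eq, abs_sub_comm y x] at this
  have h1 : |H x * (a y - a x) / (a x * a y)| ≤ M * (L * |x - y|) / (ν * ν) := by
    rw [abs_div, abs_mul, abs_of_pos (mul_pos hax hay)]
    exact div_le_div₀ (by positivity) (mul_le_mul (hM x hx) hLa (abs_nonneg _) hM0)
      (by positivity) (mul_le_mul (haν x hx) (haν y hy) hν.le hax.le)
  have h2 : |(H x - H y) / a y| ≤ C * |x - y| / ν := by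
    rw [abs_div, abs_of_pos hay]
    exact div_le_div₀ (by positivity) (hH x hx y hy) hν (haν y hy)
  rw [Real.dist_eq, Real.dist_eq, e]
  change _ ≤ (M * L / (ν * ν) + C / ν) * |x - y|
  calc _ ≤ _ := abs_add_le _ _
    _ ≤ M * (L * |x - y|) / (ν * ν) + C * |x - y| / ν := add_le_add h1 h2
    _ = _ := by ring

theorem memLp_deriv_of_lipschitz {G : ℝ → ℝ} {K : ℝ≥0} (hG : LipschitzOnWith K G (Icc 0 1)) :
    MemLp (deriv G) ∞ vol := by
  refine MemLp.of_bound (aestronglyMeasurable_deriv _ _) K ?_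
  filter_upwards [ae_vol_mem] with x hx
  exact norm_deriv_le_of_lipschitzOn (Icc_mem_nhds hx.1 hx.2) hG

theorem MemH10.memLp_top {u : ℝ → ℝ} (hu : MemH10 u) : MemLp u ∞ vol :=
  (memLp_congr_ae hu.ae_eq_prim).2 (memLp_prim (integrable_of_memLp_two hu.weakDeriv_spec.2) ∞)

theorem memLp_top_mul {f g : ℝ → ℝ} (hf : MemLp f ∞ vol) (hg : MemLp g ∞ vol) :
    MemLp (fun x => f x * g x) ∞ vol := by
  obtain ⟨C, hC0, hC⟩ := ae_bound_of_memLp_top hf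
  obtain ⟨D, hD0, hD⟩ := ae_bound_of_memLp_top hg
  refine MemLp.of_bound (hf.1.mul hg.1) (C * D) ?_
  filter_upwards [hC, hD] with x h1 h2
  rw [norm_mul]
  exact mul_le_mul h1 h2 (norm_nonneg _) hC0

theorem memLp_two_of_top {f : ℝ → ℝ} (hf : MemLp f ∞ vol) : MemLp f 2 vol :=
  hf.mono_exponent le_top

/-- The state equation integrated once: the flux `a z'` plus a primitive is constant. -/
theorem IsState.flux_const (hc : IsCoercivePair ν a d₀) {f z : ℝ → ℝ} (hf : MemLp f ∞ vol)
    (hz : IsState a d₀ f z) :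
    ∃ c, (fun x => a x * weakDeriv z x + prim (fun s => f s - d₀ s * z s) x) =ᵐ[vol]
      fun _ => c := by
  have hzm := hz.1.weakDeriv_spec.2
  have hd : MemLp (fun s => d₀ s * z s) ∞ vol := memLp_top_mul hc.memLp hz.1.memLp_top
  have hh : MemLp (fun s => f s - d₀ s * z s) 2 vol := memLp_two_of_top (hf.sub hd)
  have hhi := integrable_of_memLp_two hh
  refine ae_const_of_orthogonal ((hc.memLp_mul hzm).add (memLp_prim_two hh)) fun g hg hg0 => ?_
  have hgi := integrable_of_memLp_two hg
  have hgp := memLp_prim_two hg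
  let w : Fn := AEEqFun.mk (prim g) hgp.1
  have hw : w =ᵐ[vol] prim g := AEEqFun.coeFn_mk _ _
  obtain ⟨hw1, hw2⟩ := memH10_of_prim hg hg0 hw
  have key := hz.2 w hw1
  unfold bilin pairing at key
  have e1 : ∫ x, a x * weakDeriv z x * weakDeriv w x ∂vol = ∫ x, a x * weakDeriv z x * g x ∂vol :=
    integral_congr_ae (hw2.mono fun x hx => by simp only [hx])
  have e2 : ∫ x, d₀ x * z x * w x ∂vol = ∫ x, d₀ x * z x * prim g x ∂vol :=
    integral_congr_ae (hw.mono fun x hx => by simp only [hx])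
  have e3 : ∫ x, f x * w x ∂vol = ∫ x, f x * prim g x ∂vol :=
    integral_congr_ae (hw.mono fun x hx => by simp only [hx])
  -- The boundary terms vanish because `g` has mean zero; this turns the lower-order terms into a
  -- primitive paired with `g = w'`.
  have e4 : ∫ x, prim (fun s => f s - d₀ s * z s) x * g x ∂vol =
      -∫ x, (f x - d₀ x * z x) * prim g x ∂vol :=
    integral_mul_deriv_of_ac (absolutelyContinuous_prim hhi) (absolutelyContinuous_prim hgi)
      (deriv_prim hhi) (deriv_prim hgi) (prim_zero_right g) (by rw [prim_one, hg0])
  have e5 : ∫ x, (f x - d₀ x * z x) * prim g x ∂vol =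
      (∫ x, f x * prim g x ∂vol) - ∫ x, d₀ x * z x * prim g x ∂vol := by
    rw [← integral_sub (integrable_mul_two (memLp_two_of_top hf) hgp)
      (integrable_mul_two (memLp_two_of_top hd) hgp)]
    exact integral_congr_ae (Eventually.of_forall fun x => by ring)
  have e6 : ∫ x, (a x * weakDeriv z x + prim (fun s => f s - d₀ s * z s) x) * g x ∂vol =
      (∫ x, a x * weakDeriv z x * g x ∂vol) +
        ∫ x, prim (fun s => f s - d₀ s * z s) x * g x ∂vol := by
    rw [← integral_add (integrable_mul_two (hc.memLp_mul hzm) hg)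
      (integrable_mul_two (memLp_prim_two hh) hg)]
    exact integral_congr_ae (Eventually.of_forall fun x => by ring)
  change ∫ x, (a x * weakDeriv z x + prim (fun s => f s - d₀ s * z s) x) * g x ∂vol = 0
  rw [e6, e4, e5]
  rw [e1, e2, e3] at key
  linarith

/-- By `IsState.flux_const`, `z' = H / a` with `H` a constant minus the primitive of a bounded
function. Both `H` and `a` are Lipschitz and `a` is bounded below, so `z'` is Lipschitz and `z''` is
bounded. -/
theorem IsState.memW_two (hc : IsCoercivePair ν a d₀) {L : ℝ≥0}
    (haL : LipschitzOnWith L a (Icc 0 1)) {f z : ℝ → ℝ} (hf : MemLp f ∞ vol)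
    (hz : IsState a d₀ f z) : MemW 2 ∞ z := by
  obtain ⟨c, hflux⟩ := hz.flux_const hc hf
  have hd : MemLp (fun s => d₀ s * z s) ∞ vol := memLp_top_mul hc.memLp hz.1.memLp_top
  have hh : MemLp (fun s => f s - d₀ s * z s) ∞ vol := hf.sub hd
  have hhi := integrable_of_memLp_two (memLp_two_of_top hh)
  obtain ⟨C, hC0, hC⟩ := ae_bound_of_memLp_top hh
  let H : ℝ → ℝ := fun x => c - prim (fun s => f s - d₀ s * z s) x
  obtain ⟨M, hM⟩ := isCompact_Icc.exists_bound_of_continuousOn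
    (continuousOn_const.sub (continuousOn_prim hhi) : ContinuousOn H (Icc 0 1))
  obtain ⟨K, hK⟩ := lipschitzOn_div (H := H) (C := C) hc.pos haL hc.lower hM fun x hx y hy => by
    have := abs_prim_sub_le hhi hC hy hx
    rw [abs_sub_comm y x] at this
    simpa only [H, sub_sub_sub_cancel_left] using this
  have hG : weakDeriv z =ᵐ[vol] fun x => H x / a x := by
    filter_upwards [hflux, ae_vol_mem_Icc] with x hx hxm
    have := hc.pos.trans_le (hc.lower x hxm)
    rw [eq_div_iff this.ne']
    simp only [H]
    linarith
  have hac : AbsolutelyContinuousOnInterval (fun x => H x / a x) 0 1 :=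
    LipschitzOnWith.absolutelyContinuousOnInterval (by rwa [uIcc_of_le zero_le_one])
  have hdG := memLp_deriv_of_lipschitz hK
  exact ⟨hz.1.memLp_top, _, hz.1.weakDeriv_spec.1.congr ae_eq_rfl hG,
    memLp_of_continuousOn hK.continuousOn ∞, _,
    isWeakDeriv_of_ac hac ae_eq_rfl (integrable_of_memLp_two (memLp_two_of_top hdG)), hdG⟩

/-! ### Integration by parts against the derivative of a function of bounded variation -/

/-- The operator norm is left unevaluated, since the bound is used only for errors tending to zero.
-/
theorem abs_integral_le_tvNorm (m : SignedMeasure Dom) {f : ℝ → ℝ} {C : ℝ}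
    (hC : ∀ x ∈ Ioo (0 : ℝ) 1, |f x| ≤ C) :
    |∫ᵛ x, f (x : ℝ) ∂<•m| ≤ ‖(ContinuousLinearMap.lsmul ℝ ℝ (E := ℝ)).flip‖ * (C * tvNorm m) := by
  refine (VectorMeasure.norm_integral_le_integral_norm (μ := m) (f := fun x : Dom => f x)
    (B := (ContinuousLinearMap.lsmul ℝ ℝ (E := ℝ)).flip)).trans ?_
  refine mul_le_mul_of_nonneg_left ?_ (ContinuousLinearMap.opNorm_nonneg _)
  have := integral_mono_of_nonneg (μ := m.variation) (f := fun x : Dom => ‖f x‖)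
    (g := fun _ => C) (Eventually.of_forall fun _ => norm_nonneg _) (integrable_const C)
    (Eventually.of_forall fun x => hC x x.2)
  rw [integral_const, smul_eq_mul, mul_comm] at this
  exact this

/-- Approximate `z` uniformly by a test function `ψ`, remove the small mean of `ψ` with `unitTest`
and integrate. The mean-zero hypothesis makes `prim z` vanish at `1`, as any uniform limit of test
functions must. -/
theorem exists_uniform_approx {z : ℝ → ℝ} (hz : MemH10 z) (h0 : ∫ x, z x ∂vol = 0) :
    ∃ R, 0 ≤ R ∧ ∀ δ : ℝ, 0 < δ → ∃ φ : 𝓓(Dom, ℝ), (∀ᵐ x ∂vol, |z x - deriv φ x| ≤ δ * R) ∧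
      ∀ x ∈ Icc (0 : ℝ) 1, |prim z x - φ x| ≤ δ * R := by
  obtain ⟨R, hR⟩ := testFunction_bound unitTest
  have hR0 : 0 ≤ R := (abs_nonneg _).trans (hR 0)
  refine ⟨1 + R, by positivity, fun δ hδ => ?_⟩
  have hm := hz.weakDeriv_spec.2
  have hzi := integrable_of_memLp_two hz.memLp
  obtain ⟨ψ, hψ⟩ := exists_testFunction_deriv_nrm_lt hm hz.integral_weakDeriv hδ
  have hψd := memLp_testFunction_deriv ψ 2
  have hψm := memLp_testFunction ψ 2
  have hclose : ∀ᵐ x ∂vol, |z x - ψ x| ≤ δ := by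
    filter_upwards [hz.ae_eq_prim, ae_vol_mem_Icc] with x hx hxm
    have h5 := abs_prim_le_nrm (hm.sub hψd) hxm
    rw [prim_sub (integrable_of_memLp_two hm) (integrable_of_memLp_two hψd) hxm,
      prim_deriv_testFunction, ← hx] at h5
    exact h5.trans hψ.le
  have hmean : |∫ x, ψ x ∂vol| ≤ δ := by
    have h1 : ∫ x, (z - ⇑ψ) x ∂vol = -∫ x, ψ x ∂vol := by
      have := integral_sub hzi (integrable_of_memLp_two hψm)
      rw [h0, zero_sub] at this
      exact this
    have h2 := (abs_integral_le_nrm (hz.memLp.sub hψm)).trans (nrm_le_of_bound hδ.le hclose)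
    rwa [h1, abs_neg] at h2
  obtain ⟨φ, hφ⟩ := exists_deriv_eq_sub ψ
  have hd : ∀ᵐ x ∂vol, |z x - deriv φ x| ≤ δ * (1 + R) := by
    filter_upwards [hclose] with x hx
    have e : z x - deriv φ x = (z x - ψ x) + (∫ x, ψ x ∂vol) * unitTest x := by
      rw [hφ]
      ring
    rw [e]
    refine (abs_add_le _ _).trans ?_
    rw [abs_mul]
    have := mul_le_mul hmean (hR x) (abs_nonneg _) hδ.le
    linarith
  refine ⟨φ, hd, fun x hx => ?_⟩
  have hφd := memLp_testFunction_deriv φ 2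
  have h6 := (abs_prim_le_nrm (hz.memLp.sub hφd) hx).trans (nrm_le_of_bound (by positivity) hd)
  rwa [prim_sub hzi (integrable_of_memLp_two hφd) hx, prim_deriv_testFunction] at h6

/-- `prim z` is not a test function, so the definition of `m` is applied to approximations `φ`.
Uniform closeness of `φ` controls the integral against the finite measure `m`, and that of `φ'` the
integral against `q ∈ L¹`. -/
theorem integral_prim_measureDeriv {q z : ℝ → ℝ} {m : SignedMeasure Dom} (hq : Integrable q vol)
    (hm : IsMeasureDeriv q m) (hz : MemH10 z) (h0 : ∫ x, z x ∂vol = 0) :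
    ∫ᵛ x, prim z (x : ℝ) ∂<•m = -pairing z q := by
  obtain ⟨R, hR0, hR⟩ := exists_uniform_approx hz h0
  have hzi := integrable_of_memLp_two hz.memLp
  let N := ‖(ContinuousLinearMap.lsmul ℝ ℝ (E := ℝ)).flip‖
  let K := N * (R * tvNorm m) + R * ∫ x, |q x| ∂vol
  have hT : Tendsto (fun δ : ℝ => δ * K) (𝓝[>] 0) (𝓝 0) := by
    have : Tendsto (fun δ : ℝ => δ * K) (𝓝 0) (𝓝 (0 * K)) := tendsto_id.mul_const K
    rw [zero_mul] at this
    exact this.mono_left nhdsWithin_le_nhds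
  have hbound : ∀ δ : ℝ, 0 < δ → |∫ᵛ x, prim z (x : ℝ) ∂<•m + pairing z q| ≤ δ * K := by
    intro δ hδ
    obtain ⟨φ, h1, h2⟩ := hR δ hδ
    have hpm : m.Integrable fun x : Dom => prim z x :=
      integrable_of_continuous_bound m ((continuousOn_prim hzi).mono Ioo_subset_Icc_self)
        fun x hx => abs_prim_le hzi (Ioo_subset_Icc_self hx)
    have e1 : ∫ᵛ x, prim z (x : ℝ) ∂<•m =
        ∫ᵛ x, (prim z (x : ℝ) - φ x) ∂<•m + ∫ᵛ x, φ (x : ℝ) ∂<•m := by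
      rw [VectorMeasure.integral_fun_sub hpm (integrable_testFunction m φ), sub_add_cancel]
    have e2 : ∫ x, q x * (z x - deriv φ x) ∂vol = pairing z q + ∫ᵛ x, φ (x : ℝ) ∂<•m := by
      rw [← neg_eq_iff_eq_neg.2 (hm φ), ← sub_eq_add_neg, pairing_comm, pairing,
        ← integral_sub (hz.integrable_mul hq) (integrable_mul_deriv hq φ)]
      exact integral_congr_ae (Eventually.of_forall fun x => by ring)
    have b1 := abs_integral_le_tvNorm m (f := fun x => prim z x - φ x) (C := δ * R)
      fun x hx => h2 x (Ioo_subset_Icc_self hx)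
    have b2 : |∫ x, q x * (z x - deriv φ x) ∂vol| ≤ δ * R * ∫ x, |q x| ∂vol := by
      refine abs_integral_le_integral_abs.trans ?_
      rw [← integral_const_mul]
      have hi : Integrable (fun x => q x * (z x - deriv φ x)) vol :=
        integrable_mul_bounded hq (hz.memLp.1.sub (memLp_testFunction_deriv φ 2).1) h1
      refine integral_mono_ae hi.abs (hq.abs.const_mul _) (h1.mono fun x hx => ?_)
      simp only [abs_mul]
      rw [mul_comm]
      exact mul_le_mul_of_nonneg_right hx (abs_nonneg _)
    rw [e1, add_assoc, add_comm (∫ᵛ x, φ (x : ℝ) ∂<•m), ← e2]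
    refine (abs_add_le _ _).trans ((add_le_add b1 b2).trans (le_of_eq ?_))
    simp only [K, N]
    ring
  have h3 : |∫ᵛ x, prim z (x : ℝ) ∂<•m + pairing z q| ≤ 0 :=
    ge_of_tendsto hT (eventually_mem_nhdsWithin.mono fun δ hδ => hbound δ hδ)
  exact eq_neg_of_add_eq_zero_left (abs_eq_zero.1 (le_antisymm h3 (abs_nonneg _)))

/-! ### Optimality and the variational inequality -/

variable {α : ℝ} {ud : ℝ → ℝ} {qb ub z : Fn}

theorem coeFn_lincomb (t : ℝ) (u v : Fn) : ⇑(t • u + v : Fn) =ᵐ[vol] t • ⇑u + ⇑v := by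
  filter_upwards [AEEqFun.coeFn_add (t • u) v, AEEqFun.coeFn_smul t u] with x h1 h2
  rw [h1, Pi.add_apply, Pi.add_apply, h2]

theorem coeFn_diff (u v : Fn) : ⇑(u - v : Fn) =ᵐ[vol] (-1 : ℝ) • ⇑v + ⇑u := by
  filter_upwards [AEEqFun.coeFn_sub u v] with x hx
  rw [hx]
  simp only [Pi.sub_apply, Pi.add_apply, Pi.smul_apply, smul_eq_mul]
  ring

theorem nrm_sq_expand {e u f : ℝ → ℝ} (he : MemLp e 2 vol) (hu : MemLp u 2 vol)
    (hf : MemLp f 2 vol) {r : ℝ → ℝ} {t : ℝ} (hr : r =ᵐ[vol] t • e + u) :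
    nrm (fun x => r x - f x) ^ 2 =
      t ^ 2 * nrm e ^ 2 + 2 * t * pairing e (fun x => u x - f x) +
        nrm (fun x => u x - f x) ^ 2 := by
  have huf : MemLp (fun x => u x - f x) 2 vol := hu.sub hf
  have hrm : MemLp r 2 vol := (memLp_congr_ae hr).2 ((he.const_smul t).add hu)
  have hrf : MemLp (fun x => r x - f x) 2 vol := hrm.sub hf
  have i1 := (integrable_mul_two he he).const_mul (t ^ 2)
  have i2 := (integrable_mul_two he huf).const_mul (2 * t)
  have i3 : Integrable (fun x => t ^ 2 * (e x * e x) + 2 * t * (e x * (u x - f x))) vol :=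
    i1.add i2
  rw [nrm_sq hrf, nrm_sq he, nrm_sq huf, pairing, ← integral_const_mul,
    ← integral_const_mul, ← integral_add i1 i2,
    ← integral_add i3 (integrable_mul_two huf huf)]
  refine integral_congr_ae (hr.mono fun x hx => ?_)
  simp only [hx, Pi.add_apply, Pi.smul_apply, smul_eq_mul]
  ring

theorem reducedJ_eq {q : Fn} {r : Fn} (h : S a d₀ q = r) :
    reducedJ α a d₀ ud q =
      1 / 2 * nrm (fun x => r x - ud x) ^ 2 + α * tvNorm (measureDeriv q) := by
  rw [reducedJ, h]
  rfl

theorem MemBV.lincomb {q p r : ℝ → ℝ} (hq : MemBV q) (hp : MemBV p) (t : ℝ)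
    (hr : r =ᵐ[vol] t • q + p) :
    MemBV r ∧ measureDeriv r = t • measureDeriv q + measureDeriv p := by
  have h : IsMeasureDeriv r (t • measureDeriv q + measureDeriv p) :=
    ((hq.isMeasureDeriv.smul t).add (hq.1.const_mul t) hp.1 hp.isMeasureDeriv).congr hr.symm
  exact ⟨⟨((hq.1.smul t).add hp.1).congr hr.symm, _, h⟩, h.measureDeriv_eq⟩

theorem eq_S (hc : IsCoercivePair ν a d₀) {q u : Fn} (hq : Integrable q vol)
    (hu : IsState a d₀ q u) : S a d₀ q = u :=
  IsState.unique hc hq (isState_S hc hq) hu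

/-- By symmetry the adjoint equation is a state equation with data `ub - ud`, so solvability,
uniqueness and regularity carry over to `z`. -/
theorem isAdjointState_iff (hub : MemH10 ub) :
    IsAdjointState α a d₀ ud qb ub z ↔
      MemW 2 ∞ z ∧ IsState a d₀ (fun x => ub x - ud x) z ∧ IsState a d₀ qb ub ∧
        ∀ q : Fn, MemBV q → -pairing z (fun x => q x - qb x) ≤
          α * (tvNorm (measureDeriv q) - tvNorm (measureDeriv qb)) := by
  have hadj : (∀ w : Fn, MemH10 w → bilin a d₀ w z = pairing w (fun x => ub x - ud x)) ↔
      ∀ w : Fn, MemH10 w → bilin a d₀ z w = pairing (fun x => ub x - ud x) w := by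
    refine forall₂_congr fun w _ => ?_
    rw [bilin_comm, pairing_comm]
  unfold IsAdjointState IsState
  rw [hadj]
  tauto

/-- The derivative of the tracking term in terms of the adjoint state. -/
theorem pairing_adjoint {f d e z : ℝ → ℝ} {E Z : Fn} (hE : ⇑E = e) (hZ : ⇑Z = z)
    (he : IsState a d₀ d e) (hz : IsState a d₀ f z) : pairing e f = pairing z d := by
  subst hE hZ
  rw [pairing_comm, ← hz.2 E he.1, bilin_comm, he.2 Z hz.1, pairing_comm]

theorem variational_of_optimal (hc : IsCoercivePair ν a d₀) (hα : 0 ≤ α)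
    (hud : MemLp ud 2 vol) (hqb : MemBV qb) (hb : IsState a d₀ qb ub)
    (hz : IsState a d₀ (fun x => ub x - ud x) z)
    (hopt : ∀ q : Fn, MemBV q → reducedJ α a d₀ ud qb ≤ reducedJ α a d₀ ud q)
    (q : Fn) (hq : MemBV q) :
    -pairing z (fun x => q x - qb x) ≤
      α * (tvNorm (measureDeriv q) - tvNorm (measureDeriv qb)) := by
  let d : Fn := q - qb
  let e : Fn := S a d₀ q - ub
  obtain ⟨hdBV, hdm⟩ := hqb.lincomb hq (-1) (coeFn_diff q qb)
  have he : IsState a d₀ d e := hb.lincomb hc hqb.1 hq.1 (isState_S hc hq.1) (-1)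
    (coeFn_diff _ _) (coeFn_diff _ _)
  have hP : pairing e (fun x => ub x - ud x) = pairing z (fun x => q x - qb x) := by
    rw [pairing_adjoint rfl rfl he hz]
    exact integral_congr_ae ((AEEqFun.coeFn_sub q qb).mono fun x hx => by
      simp only [d, hx, Pi.sub_apply])
  -- Optimality against `qb + t (q - qb)`, with convexity of the total variation, after division by
  -- `t`. Letting `t` tend to `0` from the right removes the quadratic term.
  have key : ∀ t ∈ Ioo (0 : ℝ) 1, 0 ≤ t / 2 * nrm e ^ 2 +
      (pairing z (fun x => q x - qb x) +
        α * (tvNorm (measureDeriv q) - tvNorm (measureDeriv qb))) := by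
    intro t ht
    obtain ⟨htBV, htm⟩ := hdBV.lincomb hqb t (coeFn_lincomb t d qb)
    have hst : IsState a d₀ (t • d + qb : Fn) (t • e + ub : Fn) :=
      he.lincomb hc hdBV.1 hqb.1 hb t (coeFn_lincomb _ _ _) (coeFn_lincomb _ _ _)
    have h1 := hopt _ htBV
    rw [reducedJ_eq (eq_S hc hqb.1 hb), reducedJ_eq (eq_S hc htBV.1 hst),
      nrm_sq_expand he.1.memLp hb.1.memLp hud (coeFn_lincomb t e ub), hP] at h1
    have hm : measureDeriv (t • d + qb : Fn) =
        t • measureDeriv q + (1 - t) • measureDeriv qb := by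
      rw [htm, hdm]
      module
    have h2 : tvNorm (measureDeriv (t • d + qb : Fn)) ≤
        t * tvNorm (measureDeriv q) + (1 - t) * tvNorm (measureDeriv qb) := by
      rw [hm]
      refine (tvNorm_add_le _ _).trans (le_of_eq ?_)
      rw [tvNorm_smul, tvNorm_smul, abs_of_pos ht.1, abs_of_pos (sub_pos.2 ht.2)]
    have h3 := mul_le_mul_of_nonneg_left h2 hα
    refine nonneg_of_mul_nonneg_right ?_ ht.1
    linarith
  have hlim : Tendsto (fun t : ℝ => t / 2 * nrm e ^ 2 +
      (pairing z (fun x => q x - qb x) +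
        α * (tvNorm (measureDeriv q) - tvNorm (measureDeriv qb)))) (𝓝[>] 0)
      (𝓝 (0 / 2 * nrm e ^ 2 + (pairing z (fun x => q x - qb x) +
        α * (tvNorm (measureDeriv q) - tvNorm (measureDeriv qb))))) :=
    (Continuous.tendsto (by fun_prop) 0).mono_left nhdsWithin_le_nhds
  have h0 := ge_of_tendsto hlim (mem_of_superset (Ioo_mem_nhdsGT one_pos) key)
  linarith

theorem optimal_of_variational (hc : IsCoercivePair ν a d₀)
    (hud : MemLp ud 2 vol) (hqb : MemBV qb) (hb : IsState a d₀ qb ub)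
    (hz : IsState a d₀ (fun x => ub x - ud x) z)
    (hvi : ∀ q : Fn, MemBV q → -pairing z (fun x => q x - qb x) ≤
      α * (tvNorm (measureDeriv q) - tvNorm (measureDeriv qb)))
    (q : Fn) (hq : MemBV q) : reducedJ α a d₀ ud qb ≤ reducedJ α a d₀ ud q := by
  let e : Fn := S a d₀ q - ub
  have he : IsState a d₀ (q - qb : Fn) e := hb.lincomb hc hqb.1 hq.1 (isState_S hc hq.1) (-1)
    (coeFn_diff _ _) (coeFn_diff _ _)
  have hP : pairing e (fun x => ub x - ud x) = pairing z (fun x => q x - qb x) := by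
    rw [pairing_adjoint rfl rfl he hz]
    exact integral_congr_ae ((AEEqFun.coeFn_sub q qb).mono fun x hx => by
      simp only [hx, Pi.sub_apply])
  -- The exact expansion `nrm_sq_expand` is used at `t = 1`; the variational inequality bounds its
  -- linear term and the remainder is a square.
  have hS : ⇑(S a d₀ q) =ᵐ[vol] (1 : ℝ) • ⇑e + ⇑ub := by
    filter_upwards [coeFn_diff (S a d₀ q) ub] with x hx
    simp only [e, Pi.add_apply, Pi.smul_apply, smul_eq_mul, hx]
    ring
  rw [reducedJ_eq (eq_S hc hqb.1 hb), reducedJ_eq rfl,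
    nrm_sq_expand he.1.memLp hb.1.memLp hud hS, hP]
  have := hvi q hq
  nlinarith [sq_nonneg (nrm e)]

theorem isAdjointState_of_optimal (hc : IsCoercivePair ν a d₀) {L : ℝ≥0}
    (haL : LipschitzOnWith L a (Icc 0 1)) (hα : 0 ≤ α)
    (hud : MemLp ud ∞ vol) (hqb : MemBV qb) (hub : MemH10 ub)
    (hopt : IsOptimal α a d₀ ud qb ub) : ∃ z, IsAdjointState α a d₀ ud qb ub z := by
  have hf : MemLp (fun x => ub x - ud x) ∞ vol := hub.memLp_top.sub hud
  obtain ⟨z, hz⟩ := exists_isState hc (integrable_of_memLp_two (memLp_two_of_top hf))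
  have hb : IsState a d₀ qb ub := by
    rw [hopt.2.1]
    exact isState_S hc hqb.1
  exact ⟨z, (isAdjointState_iff hub).2 ⟨hz.memW_two hc haL hf, hz, hb,
    variational_of_optimal hc hα (memLp_two_of_top hud) hqb hb hz hopt.2.2⟩⟩

theorem optimal_of_isAdjointState (hc : IsCoercivePair ν a d₀)
    (hud : MemLp ud ∞ vol) (hqb : MemBV qb) (hub : MemH10 ub)
    (h : IsAdjointState α a d₀ ud qb ub z) : IsOptimal α a d₀ ud qb ub := by
  obtain ⟨-, hz, hb, hvi⟩ := (isAdjointState_iff hub).1 h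
  exact ⟨hqb, (eq_S hc hqb.1 hb).symm,
    optimal_of_variational hc (memLp_two_of_top hud) hqb hb hz hvi⟩

theorem IsAdjointState.unique (hc : IsCoercivePair ν a d₀)
    (hud : MemLp ud ∞ vol) (hub : MemH10 ub) {z' : Fn}
    (h : IsAdjointState α a d₀ ud qb ub z) (h' : IsAdjointState α a d₀ ud qb ub z') : z = z' := by
  have hf : MemLp (fun x => ub x - ud x) ∞ vol := hub.memLp_top.sub hud
  exact IsState.unique hc (integrable_of_memLp_two (memLp_two_of_top hf))
    ((isAdjointState_iff hub).1 h).2.1 ((isAdjointState_iff hub).1 h').2.1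

/-! ### The multiplier -/

/-- Allows concrete functions with known derivative as competitors, in place of classes and
`measureDeriv`. -/
theorem variational_of_isMeasureDeriv {z qb : Fn}
    (hvi : ∀ q : Fn, MemBV q → -pairing z (fun x => q x - qb x) ≤
      α * (tvNorm (measureDeriv q) - tvNorm (measureDeriv qb)))
    {p : ℝ → ℝ} {m : SignedMeasure Dom} (hp : Integrable p vol) (hm : IsMeasureDeriv p m) :
    -pairing z (fun x => p x - qb x) ≤ α * (tvNorm m - tvNorm (measureDeriv qb)) := by
  let q : Fn := AEEqFun.mk p hp.1
  have hq : q =ᵐ[vol] p := AEEqFun.coeFn_mk _ _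
  have hqm : IsMeasureDeriv q m := hm.congr hq.symm
  have h := hvi q ⟨hp.congr hq.symm, m, hqm⟩
  rw [hqm.measureDeriv_eq] at h
  have e : pairing z (fun x => q x - qb x) = pairing z (fun x => p x - qb x) :=
    integral_congr_ae (hq.mono fun x hx => by simp only [hx])
  rwa [e] at h

theorem prim_sub_prim {g : ℝ → ℝ} (hg : Integrable g vol) {y : ℝ} (hy : y ∈ Icc (0 : ℝ) 1) (c : ℝ) :
    ∫ x, g x * (Ioo y 1).indicator (fun _ => c) x ∂vol = c * (prim g 1 - prim g y) := by
  have e1 : prim g 1 - prim g y = ∫ t in y..1, g t :=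
    intervalIntegral.integral_interval_sub_left (intervalIntegrable_sub hg (by simp) (by simp))
      (intervalIntegrable_sub hg (by simp) hy)
  have e2 : (fun x => g x * (Ioo y 1).indicator (fun _ => c) x) =
      (Ioo y 1).indicator fun x => c * g x := by
    ext x
    by_cases hx : x ∈ Ioo y 1 <;> simp [hx, mul_comm]
  rw [e1, e2, integral_indicator measurableSet_Ioo, Measure.restrict_restrict measurableSet_Ioo,
    inter_eq_left.2 (Ioo_subset_Ioo_left hy.1), ← integral_Ioc_eq_integral_Ioo,
    ← intervalIntegral.integral_of_le hy.2, intervalIntegral.integral_const_mul]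

theorem multiplierConditions (hα : 0 < α) (hqb : MemBV qb) (hW : MemW 2 ∞ z) (hz : MemH10 z)
    (hvi : ∀ q : Fn, MemBV q → -pairing z (fun x => q x - qb x) ≤
      α * (tvNorm (measureDeriv q) - tvNorm (measureDeriv qb))) :
    MultiplierConditions α qb z := by
  have hzi := integrable_of_memLp_two hz.memLp
  have hqz : Integrable (fun x => z x * qb x) vol :=
    (hz.integrable_mul hqb.1).congr (Eventually.of_forall fun x => mul_comm _ _)
  -- Adding a constant of either sign to `qb` leaves the total variation unchanged.
  have hmean : ∫ x, z x ∂vol = 0 := by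
    have h (c : ℝ) : -(c * ∫ x, z x ∂vol) ≤ 0 := by
      have h1 := variational_of_isMeasureDeriv hvi (hqb.1.add (integrable_const c))
        (hqb.isMeasureDeriv.add hqb.1 (integrable_const c) (isMeasureDeriv_const c))
      rw [add_zero, sub_self, mul_zero, pairing] at h1
      rw [← integral_const_mul]
      refine le_of_eq_of_le (congrArg Neg.neg (integral_congr_ae
        (Eventually.of_forall fun x => ?_))) h1
      simp only [Pi.add_apply]
      ring
    linarith [h 1, h (-1)]
  have hscale (c : ℝ) : -((c - 1) * pairing z qb) ≤
      α * (|c| * tvNorm (measureDeriv qb) - tvNorm (measureDeriv qb)) := by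
    have h1 := variational_of_isMeasureDeriv hvi (hqb.1.const_mul c) (hqb.isMeasureDeriv.smul c)
    rw [tvNorm_smul] at h1
    refine le_of_eq_of_le (congrArg Neg.neg ?_) h1
    rw [pairing, pairing, ← integral_const_mul]
    exact integral_congr_ae (Eventually.of_forall fun x => by ring)
  -- The scalings `c = 0` and `c = 2` give the two opposite inequalities.
  have hpair : -pairing z qb = α * tvNorm (measureDeriv qb) := by
    have h0 := hscale 0
    have h2 := hscale 2
    norm_num at h0 h2
    linarith
  refine ⟨⟨memLp_prim hzi ∞, z, isWeakDeriv_prim hzi, hW⟩, ?_, ?_, fun x hx => ?_⟩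
  · exact (prim_one z).trans hmean
  · exact (integral_prim_measureDeriv hqb.1 hqb.isMeasureDeriv hz hmean).trans hpair
  · change |prim z x| ≤ α
    -- A jump must lie inside `Ω`, so the endpoints, where `Φ` vanishes, are treated apart.
    rcases eq_or_lt_of_le hx.1 with rfl | hx0
    · simpa using hα.le
    rcases eq_or_lt_of_le hx.2 with rfl | hx1
    · rw [prim_one, hmean]
      simpa using hα.le
    -- The competitor is the step of height `c` at `x`; by `hpair` the terms in `qb` cancel on both
    -- sides.
    have h (c : ℝ) : c * prim z x ≤ α * |c| := by
      have hi : Integrable ((Ioo x 1).indicator fun _ => c) vol :=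
        (integrable_const c).indicator measurableSet_Ioo
      have h1 := variational_of_isMeasureDeriv hvi hi (isMeasureDeriv_step ⟨x, hx0, hx1⟩ c)
      rw [tvNorm_dirac] at h1
      have hzi' : Integrable (fun s => z s * (Ioo x 1).indicator (fun _ => c) s) vol := by
        refine integrable_mul_bounded hzi hi.1 (C := |c|) (Eventually.of_forall fun s => ?_)
        by_cases hs : s ∈ Ioo x 1 <;> simp [hs]
      have h2 : pairing z (fun s => (Ioo x 1).indicator (fun _ => c) s - qb s) =
          c * (prim z 1 - prim z x) - pairing z qb := by
        rw [← prim_sub_prim hzi hx c, pairing, pairing, ← integral_sub hzi' hqz]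
        exact integral_congr_ae (Eventually.of_forall fun s => by ring)
      rw [h2, prim_one, hmean] at h1
      linarith
    have h1 := h 1
    have h2 := h (-1)
    rw [abs_one] at h1
    rw [abs_neg, abs_one] at h2
    exact abs_le.2 ⟨by linarith, by linarith⟩

theorem IsAdjointState.multiplierConditions (hα : 0 < α) (hqb : MemBV qb)
    (h : IsAdjointState α a d₀ ud qb ub z) : MultiplierConditions α qb z :=
  BVControl.multiplierConditions hα hqb h.1.1 h.1.2 h.2.2.2

end BVControl

theorem mainTheorem7 (α ν : ℝ) (hα : 0 < α) (hν : 0 < ν)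
    (a : ℝ → ℝ) (L : ℝ≥0) (haL : LipschitzOnWith L a (Icc 0 1))
    (haν : ∀ x ∈ Icc (0 : ℝ) 1, ν ≤ a x)
    (d₀ ud : BVControl.Fn) (hd₀ : MemLp d₀ ∞ BVControl.vol) (hud : MemLp ud ∞ BVControl.vol)
    (hd₀_nonneg : ∀ᵐ x ∂BVControl.vol, 0 ≤ d₀ x)
    (qb ub : BVControl.Fn) (hqb : BVControl.MemBV qb) (hub : BVControl.MemH10 ub) :
    (BVControl.IsOptimal α a d₀ ud qb ub ↔
      ∃! z : BVControl.Fn, BVControl.IsAdjointState α a d₀ ud qb ub z ∧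
        BVControl.MultiplierConditions α qb z) ∧
    (BVControl.IsOptimal α a d₀ ud qb ub ↔
      ∃! z : BVControl.Fn, BVControl.IsAdjointState α a d₀ ud qb ub z) := by
  have hc : BVControl.IsCoercivePair ν a d₀ := ⟨hν, haL.continuousOn, haν, hd₀, hd₀_nonneg⟩
  refine ⟨⟨fun h => ?_, ?_⟩, ⟨fun h => ?_, ?_⟩⟩
  · obtain ⟨z, hz⟩ := BVControl.isAdjointState_of_optimal hc haL hα.le hud hqb hub h
    exact ⟨z, ⟨hz, hz.multiplierConditions hα hqb⟩, fun y hy => hy.1.unique hc hud hub hz⟩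
  · rintro ⟨z, ⟨hz, -⟩, -⟩
    exact BVControl.optimal_of_isAdjointState hc hud hqb hub hz
  · obtain ⟨z, hz⟩ := BVControl.isAdjointState_of_optimal hc haL hα.le hud hqb hub h
    exact ⟨z, hz, fun y hy => hy.unique hc hud hub hz⟩
  · rintro ⟨z, hz, -⟩
    exact BVControl.optimal_of_isAdjointState hc hud hqb hub hz
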